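/- Let $\mathcal F^2(\mathbb C)$ be the Fock space of entire functions $f$ with $\|f\|^2=\frac1\pi\int_{\mathbb C}|f(z)|^2e^{-|z|^2}\,dV(z)<\infty$. Let $a,b,c\in\mathbb C$ satisfy $|a|=1$, $\bar a b+\bar b=0$ and $|c|^2e^{|b|^2}=1$, and let $\mathcal C_{a,b,c}f(z)=ce^{bz}\overline{f(\overline{az+b})}$, a conjugation (anti-linear, involutive, isometric map) of $\mathcal F^2(\mathbb C)$. A closed, densely defined operator $T$ on $\mathcal F^2(\mathbb C)$ is called $\mathcal C_{a,b,c}$-selfadjoint if $T=\mathcal C_{a,b,c}T^*\mathcal C_{a,b,c}$ (with equality of domains). Let $\psi_0,\psi_1$ be entire functions, let $T_{\max}f=\psi_0f+\psi_1f'$ with domain $\{f\in\mathcal F^2(\mathbb C):\psi_0f+\psi_1f'\in\mathcal F^2(\mathbb C)\}$, and let $T$ be the restriction of $T_{\max}$ to a linear subspace of this domain. Then $T$ is $\mathcal C_{a,b,c}$-selfadjoint if and only if $T=T_{\max}$ and $$\psi_0(z)=d_{0,0}+d_{1,0}(az+b),\qquad \psi_1(z)=d_{0,1}+d_{1,1}(az+b)\qquad\text{for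 all } z\in\mathbb C,$$ for some constants $d_{i,j}\in\mathbb C$ with $d_{1,0}=d_{0,1}$. In this case the point spectrum $\sigma_p(T)$ (the set of eigenvalues of $T$) is $$\sigma_p(T)=\begin{cases}\{\psi_0(w)+k\,\psi_1'(w):k=0,1,2,\dots\},\quad w=\dfrac{-d_{0,1}-b\,d_{1,1}}{a\,d_{1,1}},&\text{if } d_{1,1}\neq0,\\[1ex] \emptyset,&\text{if } d_{1,1}=0,\ d_{0,1}\neq0,\\ \{d_{0,0}\},&\text{if } d_{1,1}=d_{0,1}=0.\end{cases}$$ -/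

import Mathlib

open MeasureTheory Complex Filter Topology
open scoped ComplexConjugate ENNReal

/-- The density `z ↦ π⁻¹ exp (-|z|²)` on `ℂ`. -/
noncomputable def fockWeight (z : ℂ) : ℝ := Real.exp (-‖z‖ ^ 2) / Real.pi

/-- The Gaussian measure `π⁻¹ exp (-|z|²) dV(z)` on `ℂ`, with `dV` the Lebesgue measure. -/
noncomputable def fockMeasure : Measure ℂ :=
  (volume : Measure ℂ).withDensity fun z => ENNReal.ofReal (fockWeight z)

theorem fockWeight_pos (z : ℂ) : 0 < fockWeight z := by unfold fockWeight; positivity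

theorem continuous_fockWeight : Continuous fockWeight := by unfold fockWeight; fun_prop

theorem integral_fockMeasure {E : Type*} [NormedAddCommGroup E] [NormedSpace ℝ E] (g : ℂ → E) :
    ∫ z, g z ∂fockMeasure = ∫ z, fockWeight z • g z := by
  unfold fockMeasure
  rw [integral_withDensity_eq_integral_toReal_smul
    (continuous_fockWeight.measurable.ennreal_ofReal) (by simp)]
  simp [ENNReal.toReal_ofReal (fockWeight_pos _).le]

theorem integrable_fockMeasure_iff {E : Type*} [NormedAddCommGroup E] [NormedSpace ℝ E]
    (g : ℂ → E) : Integrable g fockMeasure ↔ Integrable (fun z => fockWeight z • g z) := by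
  unfold fockMeasure
  rw [integrable_withDensity_iff_integrable_smul'
    (continuous_fockWeight.measurable.ennreal_ofReal) (by simp)]
  simp [ENNReal.toReal_ofReal (fockWeight_pos _).le]

theorem volume_absolutelyContinuous_fockMeasure : (volume : Measure ℂ) ≪ fockMeasure :=
  withDensity_absolutelyContinuous'
    (continuous_fockWeight.measurable.ennreal_ofReal).aemeasurable
    (by simp [fockWeight_pos])

instance : fockMeasure.IsOpenPosMeasure :=
  volume_absolutelyContinuous_fockMeasure.isOpenPosMeasure

/-- The Fock space: the entire functions that are square integrable for the Gaussian measure. -/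
structure FockSpace where
  /-- The underlying entire function. -/
  toFun : ℂ → ℂ
  differentiable' : Differentiable ℂ toFun
  memLp' : MemLp toFun 2 fockMeasure

namespace FockSpace

instance : FunLike FockSpace ℂ ℂ where
  coe f := f.toFun
  coe_injective := by rintro ⟨⟩ ⟨⟩ h; congr

theorem differentiable (f : FockSpace) : Differentiable ℂ f := f.differentiable'
theorem memLp (f : FockSpace) : MemLp f 2 fockMeasure := f.memLp'

@[ext] theorem ext {f g : FockSpace} (h : ∀ z, f z = g z) : f = g := DFunLike.ext f g h

noncomputable instance : Zero FockSpace := ⟨⟨0, differentiable_const _, MemLp.zero⟩⟩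
noncomputable instance : Add FockSpace :=
  ⟨fun f g => ⟨f + g, f.differentiable.add g.differentiable, f.memLp.add g.memLp⟩⟩
noncomputable instance : Neg FockSpace := ⟨fun f => ⟨-f, f.differentiable.neg, f.memLp.neg⟩⟩
noncomputable instance : Sub FockSpace :=
  ⟨fun f g => ⟨f - g, f.differentiable.sub g.differentiable, f.memLp.sub g.memLp⟩⟩
noncomputable instance : SMul ℂ FockSpace :=
  ⟨fun c f => ⟨c • f, f.differentiable.const_smul c, f.memLp.const_smul c⟩⟩
noncomputable instance : SMul ℕ FockSpace := ⟨fun n f => (n : ℂ) • f⟩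
noncomputable instance : SMul ℤ FockSpace := ⟨fun n f => (n : ℂ) • f⟩

noncomputable instance : AddCommGroup FockSpace :=
  DFunLike.coe_injective.addCommGroup _ rfl (fun _ _ => rfl) (fun _ => rfl) (fun _ _ => rfl)
    (fun f n => (Nat.cast_smul_eq_nsmul ℂ n (f : ℂ → ℂ)))
    (fun f n => (Int.cast_smul_eq_zsmul ℂ n (f : ℂ → ℂ)))

/-- Passing to the underlying function, as an additive map. -/
noncomputable def coeHom : FockSpace →+ (ℂ → ℂ) where
  toFun f := f
  map_zero' := rfl
  map_add' _ _ := rfl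

noncomputable instance : Module ℂ FockSpace :=
  DFunLike.coe_injective.module ℂ coeHom (fun _ _ => rfl)

@[simp] theorem mk_apply (f : ℂ → ℂ) (h₁ h₂) (z : ℂ) : (⟨f, h₁, h₂⟩ : FockSpace) z = f z := rfl
@[simp] theorem zero_apply (z : ℂ) : (0 : FockSpace) z = 0 := rfl
@[simp] theorem add_apply (f g : FockSpace) (z : ℂ) : (f + g) z = f z + g z := rfl
@[simp] theorem neg_apply (f : FockSpace) (z : ℂ) : (-f) z = -f z := rfl
@[simp] theorem sub_apply (f g : FockSpace) (z : ℂ) : (f - g) z = f z - g z := rfl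
@[simp] theorem smul_apply (c : ℂ) (f : FockSpace) (z : ℂ) : (c • f) z = c * f z := rfl

theorem integrable_conj_mul (f g : FockSpace) :
    Integrable (fun z => conj (f z) * g z) fockMeasure := by
  have := L2.integrable_inner (𝕜 := ℂ) f.memLp.toLp g.memLp.toLp
  refine this.congr ?_
  filter_upwards [f.memLp.coeFn_toLp, g.memLp.coeFn_toLp] with z h1 h2
  rw [h1, h2, RCLike.inner_apply']

/-- The inner product `∫ conj (f z) g z dμ(z)`, conjugate linear in the first variable as
everywhere in Mathlib. -/
@[reducible]
noncomputable def core : InnerProductSpace.Core ℂ FockSpace where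
  inner f g := ∫ z, conj (f z) * g z ∂fockMeasure
  conj_inner_symm f g := by
    rw [← integral_conj]; congr 1; ext z; simp [mul_comm]
  re_inner_nonneg f := by
    have : ∀ z, conj (f z) * f z = ((‖f z‖ ^ 2 : ℝ) : ℂ) := fun z => by
      rw [mul_comm, mul_conj, normSq_eq_norm_sq]
    simp_rw [this]
    rw [integral_complex_ofReal]
    exact integral_nonneg fun z => by positivity
  add_left f g h := by
    rw [← integral_add (integrable_conj_mul f h) (integrable_conj_mul g h)]
    congr 1; ext z; simp [add_mul]
  smul_left f g r := by
    rw [← integral_const_mul]; congr 1; ext z; simp [mul_assoc]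
  definite f hf := by
    have h0 : ∀ z, conj (f z) * f z = ((‖f z‖ ^ 2 : ℝ) : ℂ) := fun z => by
      rw [mul_comm, mul_conj, normSq_eq_norm_sq]
    simp_rw [h0] at hf
    rw [integral_complex_ofReal] at hf
    have hf' : ∫ z, ‖f z‖ ^ 2 ∂fockMeasure = 0 := by exact_mod_cast hf
    have hi : Integrable (fun z => ‖f z‖ ^ 2) fockMeasure :=
      (memLp_two_iff_integrable_sq_norm f.memLp.1).1 f.memLp
    rw [integral_eq_zero_iff_of_nonneg (fun z => by positivity) hi] at hf'
    have hc : Continuous fun z => ‖f z‖ ^ 2 := by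
      have := f.differentiable.continuous; fun_prop
    have := hc.ae_eq_iff_eq (g := 0) fockMeasure continuous_const |>.1 hf'
    ext z
    simpa using congrFun this z

noncomputable instance : NormedAddCommGroup FockSpace := core.toNormedAddCommGroup
noncomputable instance : InnerProductSpace ℂ FockSpace := InnerProductSpace.ofCore core.toCore

theorem inner_def (f g : FockSpace) :
    inner ℂ f g = ∫ z, conj (f z) * g z ∂fockMeasure := rfl

theorem norm_sq_eq (f : FockSpace) : ‖f‖ ^ 2 = ∫ z, ‖f z‖ ^ 2 ∂fockMeasure := by
  rw [← inner_self_eq_norm_sq (𝕜 := ℂ), inner_def, ← integral_re (integrable_conj_mul f f)]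
  congr 1; ext z
  rw [mul_comm, RCLike.mul_conj]
  norm_cast

/-- The mean value property over the disc of radius one. -/
theorem _root_.integral_ball_of_differentiable {f : ℂ → ℂ} (hf : Differentiable ℂ f) (w : ℂ) :
    ∫ z in Metric.ball w 1, f z = Real.pi * f w := by
  have h1 : ∫ z in Metric.ball w 1, f z
      = ∫ z, (Metric.ball (0 : ℂ) 1).indicator (fun z => f (w + z)) z := by
    rw [← integral_indicator Metric.isOpen_ball.measurableSet,
      ← integral_add_left_eq_self _ w]
    congr 1; ext z
    simp [Set.indicator, Metric.mem_ball, dist_eq_norm]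
  rw [h1, ← Complex.integral_comp_polarCoord_symm]
  have h2 : ∫ p in polarCoord.target, p.1 • (Metric.ball (0 : ℂ) 1).indicator
        (fun z => f (w + z)) (Complex.polarCoord.symm p)
      = ∫ p in (Set.Ioo (0 : ℝ) 1) ×ˢ (Set.Ioo (-Real.pi) Real.pi),
          p.1 • f (circleMap w p.1 p.2) := by
    have hs : (Set.Ioo (0 : ℝ) 1) ×ˢ (Set.Ioo (-Real.pi) Real.pi) ⊆ polarCoord.target := by
      rintro ⟨r, t⟩ ⟨hr, ht⟩; exact ⟨hr.1, ht⟩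
    rw [setIntegral_eq_of_subset_of_forall_sdiff_eq_zero
      polarCoord.open_target.measurableSet hs]
    · refine setIntegral_congr_fun (measurableSet_Ioo.prod measurableSet_Ioo) ?_
      rintro ⟨r, t⟩ ⟨hr, ht⟩
      have : (Complex.polarCoord.symm (r, t)) ∈ Metric.ball (0 : ℂ) 1 := by
        rw [mem_ball_zero_iff, Complex.norm_polarCoord_symm, abs_of_pos hr.1]
        exact hr.2
      simp only [Set.indicator_of_mem this]
      congr 2
      simp [Complex.polarCoord_symm_apply, circleMap, Complex.exp_mul_I]
    · rintro ⟨r, t⟩ ⟨⟨hr, ht⟩, hn⟩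
      have : (Complex.polarCoord.symm (r, t)) ∉ Metric.ball (0 : ℂ) 1 := by
        intro h
        apply hn
        have hr' : (0 : ℝ) < r := hr
        rw [mem_ball_zero_iff, Complex.norm_polarCoord_symm, abs_of_pos hr'] at h
        exact ⟨⟨hr, h⟩, ht⟩
      simp only [Set.indicator_of_notMem this, smul_zero]
  rw [h2]
  have hcont : Continuous fun p : ℝ × ℝ => p.1 • f (circleMap w p.1 p.2) := by
    have := hf.continuous
    unfold circleMap
    fun_prop
  have hint : IntegrableOn (fun p : ℝ × ℝ => p.1 • f (circleMap w p.1 p.2))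
      ((Set.Ioo (0 : ℝ) 1) ×ˢ (Set.Ioo (-Real.pi) Real.pi)) (volume.prod volume) := by
    refine (hcont.continuousOn.integrableOn_compact
      (isCompact_Icc.prod isCompact_Icc)).mono_set
      (Set.prod_mono Set.Ioo_subset_Icc_self Set.Ioo_subset_Icc_self)
  rw [Measure.volume_eq_prod, setIntegral_prod _ hint]
  have h3 : ∀ r : ℝ, ∫ t in Set.Ioo (-Real.pi) Real.pi, r • f (circleMap w r t)
      = r • ((2 * Real.pi) • f w) := by
    intro r
    rw [integral_smul]
    congr 1
    have hav := (hf.diffContOnCl (s := Metric.ball w |r|)).circleAverage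
    rw [Real.circleAverage_def] at hav
    rw [← hav, smul_smul, mul_inv_cancel₀ (by positivity), one_smul,
      ← integral_Ioc_eq_integral_Ioo, ← intervalIntegral.integral_of_le (by linarith [Real.pi_pos])]
    have hp : Function.Periodic (fun t => f (circleMap w r t)) (2 * Real.pi) := fun t => by
      simp [periodic_circleMap w r t]
    have := hp.intervalIntegral_add_eq (-Real.pi) 0
    rw [zero_add] at this
    rw [← this]
    congr 1; ring
  simp_rw [h3]
  rw [integral_smul_const, ← integral_Ioc_eq_integral_Ioo,
    ← intervalIntegral.integral_of_le zero_le_one, integral_id]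
  simp only [real_smul]
  push_cast
  ring

/-- Point evaluations are bounded on the Fock space. -/
theorem norm_apply_sq_le (f : FockSpace) (w : ℂ) :
    ‖f w‖ ^ 2 ≤ Real.exp ((‖w‖ + 1) ^ 2) * ‖f‖ ^ 2 := by
  have hd : Differentiable ℂ fun z => f z ^ 2 := f.differentiable.pow 2
  have h := integral_ball_of_differentiable hd w
  have hi : Integrable (fun z => fockWeight z • ‖f z‖ ^ 2) :=
    (integrable_fockMeasure_iff _).1 ((memLp_two_iff_integrable_sq_norm f.memLp.1).1 f.memLp)
  have h1 : Real.pi * ‖f w‖ ^ 2 ≤ ∫ z in Metric.ball w 1, ‖f z‖ ^ 2 := by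
    have := norm_integral_le_integral_norm (μ := volume.restrict (Metric.ball w 1))
      (fun z => f z ^ 2)
    rw [h] at this
    simpa [abs_of_pos Real.pi_pos] using this
  have hcf := f.differentiable.continuous
  have hI : IntegrableOn (fun z => ‖f z‖ ^ 2) (Metric.ball w 1) :=
    ((by fun_prop : Continuous fun z => ‖f z‖ ^ 2).continuousOn.integrableOn_compact
      (isCompact_closedBall w 1)).mono_set Metric.ball_subset_closedBall
  have h2 : ∫ z in Metric.ball w 1, ‖f z‖ ^ 2 ≤
      ∫ z in Metric.ball w 1,
        (Real.pi * Real.exp ((‖w‖ + 1) ^ 2)) * (fockWeight z • ‖f z‖ ^ 2) := by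
    refine setIntegral_mono_on hI (hi.integrableOn.const_mul _) Metric.isOpen_ball.measurableSet ?_
    intro z hz
    have hz' : ‖z‖ ≤ ‖w‖ + 1 := by
      have : ‖z - w‖ < 1 := by simpa [dist_eq_norm] using hz
      linarith [norm_le_norm_add_norm_sub' z w]
    have h3 : 1 ≤ Real.pi * Real.exp ((‖w‖ + 1) ^ 2) * fockWeight z := by
      unfold fockWeight
      have : Real.pi * Real.exp ((‖w‖ + 1) ^ 2) * (Real.exp (-‖z‖ ^ 2) / Real.pi)
          = Real.exp ((‖w‖ + 1) ^ 2 - ‖z‖ ^ 2) := by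
        rw [Real.exp_sub, Real.exp_neg]; field_simp
      rw [this, Real.one_le_exp_iff, sub_nonneg]
      gcongr
    rw [smul_eq_mul, ← mul_assoc]
    exact le_mul_of_one_le_left (by positivity) h3
  have h3 : ∫ z in Metric.ball w 1, fockWeight z • ‖f z‖ ^ 2 ≤ ‖f‖ ^ 2 := by
    rw [norm_sq_eq, integral_fockMeasure]
    exact setIntegral_le_integral hi
      (Eventually.of_forall fun z => smul_nonneg (fockWeight_pos z).le (by positivity))
  rw [integral_const_mul] at h2
  have h4 := h1.trans h2
  rw [mul_assoc] at h4
  have h5 := le_of_mul_le_mul_left h4 Real.pi_pos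
  exact h5.trans (by gcongr)

theorem norm_apply_le (f : FockSpace) (w : ℂ) :
    ‖f w‖ ≤ Real.exp ((‖w‖ + 1) ^ 2) * ‖f‖ := by
  refine abs_le_of_sq_le_sq' ?_ (by positivity) |>.2
  refine (norm_apply_sq_le f w).trans ?_
  rw [mul_pow]
  gcongr
  exact le_self_pow₀ (Real.one_le_exp (by positivity)) two_ne_zero

/-- The isometric embedding of the Fock space into `L²`. -/
noncomputable def toL2 : FockSpace →ₗᵢ[ℂ] Lp ℂ 2 fockMeasure where
  toFun f := f.memLp.toLp
  map_add' f g := rfl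
  map_smul' c f := rfl
  norm_map' f := by
    have h : ‖f.memLp.toLp‖ ^ 2 = ‖f‖ ^ 2 := by
      rw [norm_sq_eq, ← inner_self_eq_norm_sq (𝕜 := ℂ), L2.inner_def,
        ← integral_re (L2.integrable_inner _ _)]
      refine integral_congr_ae ?_
      filter_upwards [f.memLp.coeFn_toLp] with z h1
      rw [h1, inner_self_eq_norm_sq]
    exact (sq_eq_sq₀ (norm_nonneg _) (norm_nonneg _)).1 h

instance : CompleteSpace FockSpace := by
  refine Metric.complete_of_cauchySeq_tendsto fun u hu => ?_
  obtain ⟨F, hF⟩ := cauchySeq_tendsto_of_complete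
    (toL2.isometry.uniformContinuous.comp_cauchySeq hu)
  have hloc : ∀ w : ℂ, CauchySeq fun n => u n w := by
    intro w
    rw [Metric.cauchySeq_iff] at hu ⊢
    intro ε hε
    obtain ⟨N, hN⟩ := hu (ε / Real.exp ((‖w‖ + 1) ^ 2)) (by positivity)
    refine ⟨N, fun m hm n hn => ?_⟩
    have h1 := hN m hm n hn
    rw [dist_eq_norm, lt_div_iff₀ (by positivity)] at h1
    rw [dist_eq_norm, ← sub_apply]
    linarith [norm_apply_le (u m - u n) w]
  choose g hg using fun w => cauchySeq_tendsto_of_complete (hloc w)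
  have hunif : TendstoLocallyUniformlyOn (fun n z => u n z) g atTop Set.univ := by
    rw [tendstoLocallyUniformlyOn_univ, tendstoLocallyUniformly_iff_forall_isCompact]
    intro K hK
    obtain ⟨R, hR⟩ := hK.isBounded.exists_norm_le
    have : UniformCauchySeqOn (fun n z => u n z) atTop K := by
      rw [Metric.uniformCauchySeqOn_iff]
      rw [Metric.cauchySeq_iff] at hu
      intro ε hε
      obtain ⟨N, hN⟩ := hu (ε / Real.exp ((R + 1) ^ 2)) (by positivity)
      refine ⟨N, fun m hm n hn w hw => ?_⟩
      have h1 := hN m hm n hn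
      rw [dist_eq_norm, lt_div_iff₀ (by positivity)] at h1
      rw [dist_eq_norm, ← sub_apply]
      have h2 := norm_apply_le (u m - u n) w
      have h3 : Real.exp ((‖w‖ + 1) ^ 2) ≤ Real.exp ((R + 1) ^ 2) := by
        have := hR w hw
        gcongr
      have := mul_le_mul_of_nonneg_right h3 (norm_nonneg (u m - u n))
      linarith
    exact this.tendstoUniformlyOn_of_tendsto fun w _ => hg w
  have hgd : Differentiable ℂ g := by
    rw [← differentiableOn_univ]
    exact hunif.differentiableOn
      (Eventually.of_forall fun n => (u n).differentiable.differentiableOn) isOpen_univ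
  have hae : F =ᵐ[fockMeasure] g := by
    obtain ⟨ns, hns, h⟩ := (tendstoInMeasure_of_tendsto_Lp hF).exists_seq_tendsto_ae
    have hall : ∀ᵐ z ∂fockMeasure, ∀ n, toL2 (u n) z = u n z :=
      ae_all_iff.2 fun n => (u n).memLp.coeFn_toLp
    filter_upwards [h, hall] with z h1 h2
    refine tendsto_nhds_unique h1 ?_
    simp only [Function.comp_apply, h2]
    exact (hg z).comp hns.tendsto_atTop
  have hgL : MemLp g 2 fockMeasure := (memLp_congr_ae hae).1 (Lp.memLp F)
  let G : FockSpace := ⟨g, hgd, hgL⟩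
  have hG : toL2 G = F := by
    refine Lp.ext ?_
    exact hgL.coeFn_toLp.trans hae.symm
  refine ⟨G, ?_⟩
  rw [← hG] at hF
  exact toL2.isometry.isUniformInducing.isInducing.tendsto_nhds_iff.2 hF

end FockSpace

/-- A conjugation: an anti-linear, involutive and isometric map. -/
structure Conjugation (H : Type*) [NormedAddCommGroup H] [InnerProductSpace ℂ H] extends
    H →ₛₗ[starRingEnd ℂ] H where
  involutive' : ∀ x, toFun (toFun x) = x
  norm_map' : ∀ x, ‖toFun x‖ = ‖x‖

namespace Conjugation

variable {H : Type*} [NormedAddCommGroup H] [InnerProductSpace ℂ H]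

/-- The unbounded operator `C A C`, with domain `{f | C f ∈ dom A}`. -/
def conjugate (C : Conjugation H) (A : H →ₗ.[ℂ] H) : H →ₗ.[ℂ] H where
  domain := A.domain.comap C.toLinearMap
  toFun :=
    { toFun := fun f => C.toLinearMap (A ⟨C.toLinearMap f, f.2⟩)
      map_add' := fun f g => by
        rw [← map_add, ← LinearPMap.map_add]
        congr 2
        exact Subtype.ext (map_add C.toLinearMap (f : H) (g : H))
      map_smul' := fun r f => by
        have h : (⟨C.toLinearMap ((r • f : A.domain.comap C.toLinearMap) : H), (r • f).2⟩ :
            A.domain) = (starRingEnd ℂ r) • ⟨C.toLinearMap f, f.2⟩ :=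
          Subtype.ext (map_smulₛₗ C.toLinearMap r (f : H))
        rw [h, LinearPMap.map_smul, map_smulₛₗ, Complex.conj_conj]
        rfl }

end Conjugation

section Operators

variable {H : Type*} [NormedAddCommGroup H] [InnerProductSpace ℂ H]

/-- A closed, densely defined operator `T` is `C`-selfadjoint if `T = C T* C`. -/
def IsCSelfadjoint [CompleteSpace H] (C : Conjugation H) (T : H →ₗ.[ℂ] H) : Prop :=
  T.IsClosed ∧ Dense (T.domain : Set H) ∧ T = C.conjugate T.adjoint

/-- The point spectrum: the set of eigenvalues. -/
def pointSpectrum (T : H →ₗ.[ℂ] H) : Set ℂ :=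
  {μ | ∃ f : T.domain, (f : H) ≠ 0 ∧ T f = μ • (f : H)}

end Operators

/-- The conditions on `a`, `b`, `c` under which `f ↦ c e^{bz} conj (f (conj (a z + b)))` is a
conjugation of the Fock space. -/
structure IsConjugationParam (a b c : ℂ) : Prop where
  norm_a : ‖a‖ = 1
  ab : conj a * b + conj b = 0
  c_b : ‖c‖ ^ 2 * Real.exp (‖b‖ ^ 2) = 1

namespace IsConjugationParam

variable {a b c : ℂ}

theorem a_mul_conj (h : IsConjugationParam a b c) : a * conj a = 1 := by
  rw [mul_conj, normSq_eq_norm_sq, h.norm_a]; simp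

theorem a_mul_conj_b (h : IsConjugationParam a b c) : a * conj b = -b := by
  linear_combination a * h.ab - b * h.a_mul_conj

theorem affine_affine (h : IsConjugationParam a b c) (z : ℂ) :
    conj (a * conj (a * z + b) + b) = z := by
  have h1 := congrArg conj h.a_mul_conj
  have h2 := congrArg conj h.a_mul_conj_b
  simp only [map_add, map_mul, conj_conj, map_neg, map_one] at h1 h2 ⊢
  linear_combination z * h1 + h2

theorem weight_identity (h : IsConjugationParam a b c) (z : ℂ) :
    fockWeight z * ‖c * exp (b * z)‖ ^ 2 = fockWeight (conj (a * z + b)) := by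
  have e1 : ‖conj (a * z + b)‖ ^ 2 = ‖z‖ ^ 2 - 2 * (b * z).re + ‖b‖ ^ 2 := by
    have h1 := h.a_mul_conj
    have h2 := h.a_mul_conj_b
    have h3 := congrArg conj h2
    rw [← ofReal_inj]
    have h4 : (((b * z).re : ℝ) : ℂ) = (b * z + conj (b * z)) / 2 := re_eq_add_conj _
    push_cast
    rw [h4, ← mul_conj', ← mul_conj', ← mul_conj']
    simp only [map_add, map_mul, conj_conj, map_neg] at h3 ⊢
    linear_combination z * conj z * h1 + z * h2 + conj z * h3
  have hc := h.c_b
  unfold fockWeight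
  rw [e1, norm_mul, mul_pow, norm_exp, ← Real.exp_nat_mul]
  have : ‖c‖ ^ 2 = Real.exp (-‖b‖ ^ 2) := by
    rw [Real.exp_neg]; exact eq_inv_of_mul_eq_one_left hc
  rw [this]
  have : Real.exp (-(‖z‖ ^ 2 - 2 * (b * z).re + ‖b‖ ^ 2))
      = Real.exp (-‖z‖ ^ 2) * (Real.exp (-‖b‖ ^ 2) * Real.exp ((2 : ℕ) * (b * z).re)) := by
    rw [← Real.exp_add, ← Real.exp_add]; congr 1; push_cast; ring
  rw [this]; ring

theorem measurePreserving (h : IsConjugationParam a b c) :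
    MeasurePreserving (fun z : ℂ => conj (a * z + b)) := by
  obtain ⟨u, hu⟩ : ∃ u : Circle, (u : ℂ) = a :=
    ⟨⟨a, mem_sphere_zero_iff_norm.2 h.norm_a⟩, rfl⟩
  let e : ℂ ≃ₗᵢ[ℝ] ℂ := (rotation u).trans conjLIE
  have h1 := (measurePreserving_add_right (volume : Measure ℂ) (conj b)).comp e.measurePreserving
  have h2 : (fun z : ℂ => conj (a * z + b)) = (fun x => x + conj b) ∘ e := by
    funext z
    simp [e, hu]
  rw [h2]
  exact h1

/-- The change of variables behind the isometry of the conjugation. -/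
theorem integrable_comp_iff (h : IsConjugationParam a b c) {g : ℂ → ℝ} (hg : Continuous g) :
    Integrable (fun z => ‖c * exp (b * z)‖ ^ 2 * g (conj (a * z + b))) fockMeasure
      ↔ Integrable g fockMeasure := by
  rw [integrable_fockMeasure_iff, integrable_fockMeasure_iff]
  have hm : AEStronglyMeasurable (fun z => fockWeight z • g z) (volume : Measure ℂ) :=
    (continuous_fockWeight.smul hg).aestronglyMeasurable
  rw [← h.measurePreserving.integrable_comp hm]
  simp only [Function.comp_def, smul_eq_mul, ← mul_assoc, h.weight_identity]

theorem integral_comp (h : IsConjugationParam a b c) {g : ℂ → ℝ} (hg : Continuous g) :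
    ∫ z, ‖c * exp (b * z)‖ ^ 2 * g (conj (a * z + b)) ∂fockMeasure = ∫ z, g z ∂fockMeasure := by
  rw [integral_fockMeasure, integral_fockMeasure]
  have hm : AEStronglyMeasurable (fun z => fockWeight z • g z)
      (Measure.map (fun z : ℂ => conj (a * z + b)) volume) :=
    (continuous_fockWeight.smul hg).aestronglyMeasurable
  have h1 := integral_map h.measurePreserving.measurable.aemeasurable hm
  rw [h.measurePreserving.map_eq] at h1
  rw [h1]
  simp only [smul_eq_mul, ← mul_assoc, h.weight_identity]

theorem norm_sq_wcc (f : FockSpace) (z : ℂ) :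
    ‖c * exp (b * z) * conj (f (conj (a * z + b)))‖ ^ 2
      = ‖c * exp (b * z)‖ ^ 2 * ‖f (conj (a * z + b))‖ ^ 2 := by
  rw [norm_mul (c * exp (b * z)), mul_pow, RCLike.norm_conj]

theorem differentiable_wcc (f : FockSpace) :
    Differentiable ℂ fun z => c * exp (b * z) * conj (f (conj (a * z + b))) := by
  have h1 : Differentiable ℂ (conj ∘ f ∘ conj) := fun z =>
    differentiableAt_conj_conj_iff.2 (f.differentiable _)
  have h2 : Differentiable ℂ fun z : ℂ => a * z + b := by fun_prop
  have h3 : Differentiable ℂ fun z : ℂ => c * exp (b * z) := by fun_prop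
  exact h3.mul (h1.comp h2)

end IsConjugationParam

/-- The weighted composition conjugation `f ↦ c e^{bz} conj (f (conj (a z + b)))`. -/
noncomputable def weightedConjugation {a b c : ℂ} (h : IsConjugationParam a b c) :
    Conjugation FockSpace where
  toFun f :=
    { toFun := fun z => c * exp (b * z) * conj (f (conj (a * z + b)))
      differentiable' := IsConjugationParam.differentiable_wcc f
      memLp' := by
        rw [memLp_two_iff_integrable_sq_norm
          (IsConjugationParam.differentiable_wcc f).continuous.aestronglyMeasurable]
        simp only [IsConjugationParam.norm_sq_wcc]
        have hc := f.differentiable.continuous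
        refine (h.integrable_comp_iff (g := fun z => ‖f z‖ ^ 2) (by fun_prop)).2 ?_
        exact (memLp_two_iff_integrable_sq_norm f.memLp.1).1 f.memLp }
  map_add' f g := by
    ext z; simp [mul_add]
  map_smul' r f := by
    ext z; simp [mul_left_comm]
  involutive' f := by
    ext z
    have h1 : c * exp (b * z) * conj (c * exp (b * conj (a * z + b))) = 1 := by
      have h2 := h.a_mul_conj_b
      have h3 := congrArg (fun x : ℝ => (x : ℂ)) h.c_b
      simp only [ofReal_mul, ofReal_pow, ofReal_exp, ofReal_one, ← mul_conj'] at h3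
      have h4 : exp (b * z) * conj (exp (b * conj (a * z + b))) = exp (b * conj b) := by
        rw [← exp_conj, ← exp_add]
        congr 1
        simp only [map_add, map_mul, conj_conj]
        linear_combination z * h2
      rw [map_mul]
      linear_combination c * conj c * h4 + h3
    have h2 := h.affine_affine z
    simp only [FockSpace.mk_apply, map_mul, conj_conj] at h1 ⊢
    rw [h2]
    linear_combination f z * h1
  norm_map' f := by
    refine (sq_eq_sq₀ (norm_nonneg _) (norm_nonneg _)).1 ?_
    rw [FockSpace.norm_sq_eq, FockSpace.norm_sq_eq]
    simp only [FockSpace.mk_apply, IsConjugationParam.norm_sq_wcc]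
    have hc := f.differentiable.continuous
    exact h.integral_comp (g := fun z => ‖f z‖ ^ 2) (by fun_prop)

theorem weightedConjugation_apply {a b c : ℂ} (h : IsConjugationParam a b c) (f : FockSpace)
    (z : ℂ) : (weightedConjugation h).toLinearMap f z
      = c * exp (b * z) * conj (f (conj (a * z + b))) := rfl

/-- The differential expression `∑ j ≤ κ, ψ j * f⁽ʲ⁾`. -/
noncomputable def diffExpr {κ : ℕ} (ψ : Fin (κ + 1) → ℂ → ℂ) (f : ℂ → ℂ) (z : ℂ) : ℂ :=
  ∑ j : Fin (κ + 1), ψ j z * iteratedDeriv j f z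

theorem diffExpr_add {κ : ℕ} (ψ : Fin (κ + 1) → ℂ → ℂ) (f g : FockSpace) (z : ℂ) :
    diffExpr ψ (f + g : FockSpace) z = diffExpr ψ f z + diffExpr ψ g z := by
  unfold diffExpr
  rw [← Finset.sum_add_distrib]
  refine Finset.sum_congr rfl fun j _ => ?_
  have : ((f + g : FockSpace) : ℂ → ℂ) = f + g := rfl
  rw [this, iteratedDeriv_add f.differentiable.contDiff.contDiffAt
    g.differentiable.contDiff.contDiffAt, mul_add]

theorem diffExpr_smul {κ : ℕ} (ψ : Fin (κ + 1) → ℂ → ℂ) (r : ℂ) (f : FockSpace) (z : ℂ) :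
    diffExpr ψ (r • f : FockSpace) z = r * diffExpr ψ f z := by
  unfold diffExpr
  rw [Finset.mul_sum]
  refine Finset.sum_congr rfl fun j _ => ?_
  have : ((r • f : FockSpace) : ℂ → ℂ) = r • (f : ℂ → ℂ) := rfl
  rw [this, iteratedDeriv_const_smul_field, smul_eq_mul]
  ring

/-- The maximal differential operator: `f ↦ ∑ j ≤ κ, ψ j * f⁽ʲ⁾` on the domain of all `f` in the
Fock space for which the result lies in the Fock space. -/
noncomputable def maximalOperator {κ : ℕ} (ψ : Fin (κ + 1) → ℂ → ℂ) :
    FockSpace →ₗ.[ℂ] FockSpace where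
  domain :=
    { carrier := {f | ∃ g : FockSpace, ∀ z, g z = diffExpr ψ f z}
      zero_mem' := ⟨0, fun z => by simpa using (diffExpr_smul ψ 0 0 z).symm⟩
      add_mem' := by
        rintro f₁ f₂ ⟨g₁, h₁⟩ ⟨g₂, h₂⟩
        exact ⟨g₁ + g₂, fun z => by rw [diffExpr_add, ← h₁, ← h₂, FockSpace.add_apply]⟩
      smul_mem' := by
        rintro r f ⟨g, h⟩
        exact ⟨r • g, fun z => by rw [diffExpr_smul, ← h, FockSpace.smul_apply]⟩ }
  toFun :=
    { toFun := fun f => f.2.choose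
      map_add' := fun f g => by
        ext z
        rw [FockSpace.add_apply, f.2.choose_spec, g.2.choose_spec, (f + g).2.choose_spec]
        exact diffExpr_add ψ f g z
      map_smul' := fun r f => by
        ext z
        rw [RingHom.id_apply, FockSpace.smul_apply, f.2.choose_spec, (r • f).2.choose_spec]
        exact diffExpr_smul ψ r f z }

theorem maximalOperator_apply {κ : ℕ} (ψ : Fin (κ + 1) → ℂ → ℂ)
    (f : (maximalOperator ψ).domain) (z : ℂ) :
    maximalOperator ψ f z = diffExpr ψ (f : FockSpace) z :=
  f.2.choose_spec z

/-! Everything is tested against reproducing kernels. For any densely defined `T ≤ Tmax`, the value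
of `T f` at `z` is `ψ₀(z) f(z) + ψ₁(z) f'(z)`, so the kernel `K_z` lies in the domain of `T*`, and
`T* K_z` is a combination of `K_z` and the kernel of derivative evaluation at `z`. If `T = C T* C`,
then `T (C K_z) = C (T* K_z)`. Evaluating at `x` and dividing by a nonvanishing exponential gives
`ψ₀(z) + ψ₁(z)(ax + b) = ψ₀(x) + ψ₁(x)(az + b)` (`IsCSelfadjoint.symm_coeff`). Two choices of `x`
then force the affine form with `d₁₀ = d₀₁`.

Conversely, for affine coefficients the adjoint of `Tmax` is the maximal operator of the formally
adjoint expression (`mem_graph_adjoint_maximalOperator_iff`). One inclusion is again a test on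
kernels. The other is Green's formula on maximal domains (`FockSpace.inner_eq_inner_of_affine`): in
Taylor coefficients the partial sums telescope to a boundary term, which converges and is at most
`√(n+1)` times a summable sequence, so its limit is zero. Conjugating the formal adjoint by `C`
gives the original expression back precisely because of the symmetry of the coefficients. Since
adjoints reverse inclusions, a `C`-selfadjoint restriction of `Tmax` cannot be proper.

The eigenvalue equation is a first order linear ODE. At a simple zero `w` of `ψ₁`, the order `k` of
vanishing of an eigenfunction determines the eigenvalue, and `(z - w)^k e^{lz}` realizes each `k`.
If `ψ₁` is a nonzero constant, solutions are multiples of `exp(lz - az²/2)`, which with `|a| = 1`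
has exactly the critical growth that excludes it from the space. If `ψ₁ = 0`, the operator is a
scalar. -/

/-! ### Growth criterion and quasi-monomials in the Fock space. -/

/-- Entire functions of sufficiently small Gaussian growth are square integrable. -/
theorem memLp_fockMeasure_of_norm_le {f : ℂ → ℂ} (hf : Continuous f) {C : ℝ}
    (hC : ∀ z, ‖f z‖ ≤ C * Real.exp (‖z‖ ^ 2 / 4)) : MemLp f 2 fockMeasure := by
  rw [memLp_two_iff_integrable_sq_norm hf.aestronglyMeasurable, integrable_fockMeasure_iff]
  have h1 : Integrable (fun z : ℂ => C ^ 2 / Real.pi * Real.exp (-(1 / 2) * ‖z‖ ^ 2)) := by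
    refine Integrable.const_mul ?_ _
    have := (GaussianFourier.integrable_cexp_neg_mul_sq_norm_add (V := ℂ) (b := 1 / 2)
      (by norm_num) 0 0).norm
    refine this.congr (Eventually.of_forall fun z => ?_)
    simp only [norm_exp]
    congr 1
    rw [show -(1 / 2 : ℂ) * (‖z‖ : ℂ) ^ 2 + 0 * ((inner ℝ (0 : ℂ) z : ℝ) : ℂ)
      = ((-(1 / 2) * ‖z‖ ^ 2 : ℝ) : ℂ) by push_cast; ring, ofReal_re]
  refine h1.mono' (continuous_fockWeight.smul (hf.norm.pow 2)).aestronglyMeasurable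
    (Eventually.of_forall fun z => ?_)
  rw [norm_smul, Real.norm_of_nonneg (fockWeight_pos z).le, norm_pow, norm_norm]
  have h2 : ‖f z‖ ^ 2 ≤ C ^ 2 * Real.exp (‖z‖ ^ 2 / 2) := by
    refine (pow_le_pow_left₀ (norm_nonneg _) (hC z) 2).trans_eq ?_
    rw [mul_pow, ← Real.exp_nat_mul]
    congr 2; push_cast; ring
  refine (mul_le_mul_of_nonneg_left h2 (fockWeight_pos z).le).trans_eq ?_
  unfold fockWeight
  rw [show Real.exp (-‖z‖ ^ 2) / Real.pi * (C ^ 2 * Real.exp (‖z‖ ^ 2 / 2))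
    = C ^ 2 / Real.pi * (Real.exp (-‖z‖ ^ 2) * Real.exp (‖z‖ ^ 2 / 2)) by ring, ← Real.exp_add]
  congr 2; ring

theorem memLp_pow_mul_exp (w l : ℂ) (k : ℕ) :
    MemLp (fun z => (z - w) ^ k * exp (l * z)) 2 fockMeasure := by
  refine memLp_fockMeasure_of_norm_le (by fun_prop)
    (C := k.factorial * Real.exp (‖w‖ + (1 + ‖l‖) ^ 2)) fun z => ?_
  have h1 : ‖z - w‖ ^ k ≤ k.factorial * Real.exp (‖z‖ + ‖w‖) := by
    have h := Real.pow_div_factorial_le_exp ‖z - w‖ (norm_nonneg _) k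
    rw [div_le_iff₀ (by positivity), mul_comm] at h
    refine h.trans ?_
    gcongr
    exact norm_sub_le z w
  have h2 : ‖exp (l * z)‖ ≤ Real.exp (‖l‖ * ‖z‖) := by
    rw [norm_exp, ← norm_mul]
    exact Real.exp_le_exp.2 (re_le_norm _)
  rw [norm_mul, norm_pow]
  refine (mul_le_mul h1 h2 (norm_nonneg _) (by positivity)).trans ?_
  rw [mul_assoc, mul_assoc, ← Real.exp_add, ← Real.exp_add]
  refine mul_le_mul_of_nonneg_left (Real.exp_le_exp.2 ?_) (by positivity)
  -- Completing the square absorbs `(1 + ‖l‖)‖z‖` into `‖z‖²/4`, at the cost of the `(1 + ‖l‖)²` in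
  -- `C`.
  nlinarith [sq_nonneg (‖z‖ / 2 - (1 + ‖l‖))]

namespace FockSpace

/-- The function `z ↦ (z - w) ^ k * exp (l z)` as an element of the Fock space. -/
noncomputable def powMulExp (w l : ℂ) (k : ℕ) : FockSpace :=
  ⟨fun z => (z - w) ^ k * exp (l * z), by fun_prop, memLp_pow_mul_exp w l k⟩

theorem powMulExp_apply (w l : ℂ) (k : ℕ) (z : ℂ) :
    powMulExp w l k z = (z - w) ^ k * exp (l * z) := rfl

/-- The monomials. -/
noncomputable def monomial (n : ℕ) : FockSpace := powMulExp 0 0 n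

@[simp] theorem monomial_apply (n : ℕ) (z : ℂ) : monomial n z = z ^ n := by
  simp [monomial, powMulExp_apply]

end FockSpace

/-! ### Taylor coefficients as inner products; the monomial basis. -/

/-- On the circle `conj z = r²/z`, so this is Cauchy's formula for the `n`-th derivative. -/
theorem integral_circle_conj_pow_mul {f : ℂ → ℂ} (hf : Differentiable ℂ f) (n : ℕ) {r : ℝ}
    (hr : 0 < r) :
    ∫ t in Set.Ioo (-Real.pi) Real.pi, conj (circleMap 0 r t) ^ n * f (circleMap 0 r t)
      = 2 * Real.pi * (r : ℂ) ^ (2 * n) / n.factorial * iteratedDeriv n f 0 := by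
  have h1 := hf.differentiableOn.circleIntegral_one_div_sub_center_pow_smul (c := 0) hr n
  rw [circleIntegral] at h1
  have h2 : ∀ t : ℝ, deriv (circleMap 0 r) t •
      ((1 / (circleMap 0 r t - 0) ^ (n + 1)) • f (circleMap 0 r t))
        = I / (r : ℂ) ^ (2 * n) * (conj (circleMap 0 r t) ^ n * f (circleMap 0 r t)) := by
    intro t
    have h3 : circleMap 0 r t ≠ 0 := circleMap_ne_center hr.ne'
    have h4 : (r : ℂ) ^ (2 * n) = circleMap 0 r t ^ n * conj (circleMap 0 r t) ^ n := by
      rw [← mul_pow, mul_conj, normSq_eq_norm_sq, norm_circleMap_zero, pow_mul]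
      simp
    have h5 : conj (circleMap 0 r t) ≠ 0 := by simpa using h3
    rw [deriv_circleMap, h4]
    simp only [smul_eq_mul, sub_zero]
    field_simp
    ring
  simp_rw [h2] at h1
  rw [intervalIntegral.integral_const_mul] at h1
  have hp : Function.Periodic
      (fun t => conj (circleMap 0 r t) ^ n * f (circleMap 0 r t)) (2 * Real.pi) := fun t => by
    simp [periodic_circleMap 0 r t]
  have h6 := hp.intervalIntegral_add_eq (-Real.pi) 0
  rw [zero_add] at h6
  rw [← h6, show -Real.pi + 2 * Real.pi = Real.pi by ring,
    intervalIntegral.integral_of_le (by linarith [Real.pi_pos]),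
    integral_Ioc_eq_integral_Ioo] at h1
  have hr' : (r : ℂ) ^ (2 * n) ≠ 0 := pow_ne_zero _ (ofReal_ne_zero.2 hr.ne')
  have hfac : (n.factorial : ℂ) ≠ 0 := by exact_mod_cast n.factorial_ne_zero
  simp only [smul_eq_mul] at h1
  field_simp at h1 ⊢
  linear_combination h1

theorem integrableOn_comp_polarCoord_symm {g : ℂ → ℂ} (hg : Continuous g) (hi : Integrable g) :
    IntegrableOn (fun p : ℝ × ℝ => p.1 • g (Complex.polarCoord.symm p)) polarCoord.target := by
  have hc : Continuous fun p : ℝ × ℝ => p.1 • g (Complex.polarCoord.symm p) := by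
    simp only [Complex.polarCoord_symm_apply]
    fun_prop
  refine ⟨hc.aestronglyMeasurable, ?_⟩
  have h1 := Complex.lintegral_comp_polarCoord_symm fun z => ‖g z‖ₑ
  have h2 : ∫⁻ z, ‖g z‖ₑ < ∞ := hi.2
  rw [← h1] at h2
  refine lt_of_le_of_lt (le_of_eq ?_) h2
  refine setLIntegral_congr_fun polarCoord.open_target.measurableSet fun p hp => ?_
  have hp' : 0 < p.1 := hp.1
  simp only [enorm_smul, smul_eq_mul]
  rw [Real.enorm_eq_ofReal hp'.le]

namespace FockSpace

/-- The inner product against a monomial is a Taylor coefficient. -/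
theorem inner_monomial (n : ℕ) (f : FockSpace) :
    inner ℂ (monomial n) f = iteratedDeriv n f 0 := by
  have hi := (integrable_fockMeasure_iff _).1 (integrable_conj_mul (monomial n) f)
  rw [inner_def, integral_fockMeasure, ← Complex.integral_comp_polarCoord_symm]
  have hcf := f.differentiable.continuous
  have hc : Continuous fun z => fockWeight z • (conj (monomial n z) * f z) := by
    have := continuous_fockWeight
    simp only [monomial_apply]
    fun_prop
  have hint := integrableOn_comp_polarCoord_symm hc hi
  rw [polarCoord_target] at hint ⊢
  rw [Measure.volume_eq_prod] at hint ⊢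
  rw [setIntegral_prod _ hint]
  have h1 : ∀ r ∈ Set.Ioi (0 : ℝ), ∫ t in Set.Ioo (-Real.pi) Real.pi,
      r • fockWeight (Complex.polarCoord.symm (r, t)) •
        (conj (monomial n (Complex.polarCoord.symm (r, t))) * f (Complex.polarCoord.symm (r, t)))
      = ((r ^ ((2 * n + 1 : ℕ) : ℝ) * Real.exp (- r ^ (2 : ℝ)) : ℝ)
        * (2 / n.factorial * iteratedDeriv n f 0)) := by
    intro r hr
    have hr : 0 < r := hr
    have h2 : ∀ t : ℝ, Complex.polarCoord.symm (r, t) = circleMap 0 r t := fun t => by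
      simp [Complex.polarCoord_symm_apply, circleMap, Complex.exp_mul_I]
    have h3 : ∀ t : ℝ, fockWeight (circleMap 0 r t) = Real.exp (-r ^ 2) / Real.pi := fun t => by
      rw [fockWeight, norm_circleMap_zero, sq_abs]
    simp_rw [h2, h3, monomial_apply, map_pow]
    rw [integral_smul, integral_smul, integral_circle_conj_pow_mul f.differentiable n hr]
    rw [Real.rpow_natCast, show (2 : ℝ) = (2 : ℕ) by norm_num, Real.rpow_natCast]
    simp only [real_smul]
    have : (Real.pi : ℂ) ≠ 0 := ofReal_ne_zero.2 Real.pi_ne_zero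
    push_cast
    field_simp
    ring
  -- The radial integral of `r^(2n+1) exp(-r²)` is `n!/2`, which cancels the factor `2/n!`.
  rw [setIntegral_congr_fun measurableSet_Ioi h1, integral_mul_const, integral_complex_ofReal,
    _root_.integral_rpow_mul_exp_neg_rpow (by norm_num) (lt_of_lt_of_le (by norm_num)
      (Nat.cast_nonneg _)),
    show (((2 * n + 1 : ℕ) : ℝ) + 1) / 2 = n + 1 by push_cast; ring, Real.Gamma_nat_eq_factorial]
  have hfac : (n.factorial : ℂ) ≠ 0 := by exact_mod_cast n.factorial_ne_zero
  push_cast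
  field_simp

theorem iteratedDeriv_monomial (m n : ℕ) :
    iteratedDeriv m (monomial n) 0 = if m = n then (n.factorial : ℂ) else 0 := by
  have : (monomial n : ℂ → ℂ) = fun z => z ^ n := funext (monomial_apply n)
  rw [this, iteratedDeriv_fun_pow_zero]
  split_ifs <;> simp_all

theorem eq_zero_of_iteratedDeriv {f : ℂ → ℂ} (hf : Differentiable ℂ f)
    (h : ∀ n, iteratedDeriv n f 0 = 0) (z : ℂ) : f z = 0 := by
  have := hasSum_taylorSeries_of_entire hf 0 z
  simp only [h, smul_zero] at this
  exact this.unique hasSum_zero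

/-- The normalized monomials. -/
noncomputable def onb (n : ℕ) : FockSpace := ((Real.sqrt n.factorial : ℝ) : ℂ)⁻¹ • monomial n

theorem inner_onb (n : ℕ) (f : FockSpace) :
    inner ℂ (onb n) f = ((Real.sqrt n.factorial : ℝ) : ℂ)⁻¹ * iteratedDeriv n f 0 := by
  rw [onb, inner_smul_left, inner_monomial, map_inv₀, conj_ofReal]

theorem orthonormal_onb : Orthonormal ℂ onb := by
  rw [orthonormal_iff_ite]
  intro m n
  rw [onb, onb, inner_smul_left, inner_smul_right, inner_monomial, iteratedDeriv_monomial,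
    map_inv₀, conj_ofReal]
  split_ifs with h
  · subst h
    have h0 : (0 : ℝ) < m.factorial := by exact_mod_cast m.factorial_pos
    have h1 : ((Real.sqrt m.factorial : ℝ) : ℂ) ≠ 0 :=
      ofReal_ne_zero.2 (Real.sqrt_pos.2 h0).ne'
    have h2 : ((Real.sqrt m.factorial : ℝ) : ℂ) * (Real.sqrt m.factorial : ℝ) = m.factorial := by
      rw [← ofReal_mul, Real.mul_self_sqrt h0.le]; simp
    rw [← h2]
    field_simp
  · simp

theorem eq_zero_of_inner_monomial {f : FockSpace} (h : ∀ n, inner ℂ (monomial n) f = 0) :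
    f = 0 := by
  ext z
  refine eq_zero_of_iteratedDeriv f.differentiable (fun n => ?_) z
  rw [← inner_monomial, h]

/-- The normalized monomials as a Hilbert basis. -/
noncomputable def hilbertBasis : HilbertBasis ℕ ℂ FockSpace :=
  HilbertBasis.mkOfOrthogonalEqBot orthonormal_onb (by
    rw [Submodule.eq_bot_iff]
    intro f hf
    refine eq_zero_of_inner_monomial fun n => ?_
    have h1 := (Submodule.mem_orthogonal _ _).1 hf (onb n) (Submodule.subset_span ⟨n, rfl⟩)
    have h0 : (0 : ℝ) < n.factorial := by exact_mod_cast n.factorial_pos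
    rw [inner_onb, mul_eq_zero] at h1
    rw [inner_monomial]
    refine h1.resolve_left (inv_ne_zero (ofReal_ne_zero.2 (Real.sqrt_pos.2 h0).ne')))

theorem hilbertBasis_apply (n : ℕ) : hilbertBasis n = onb n := by
  simp [hilbertBasis]

end FockSpace

/-! ### Reproducing kernels and Parseval in Taylor coefficients. -/

namespace FockSpace

/-- Point evaluation as a bounded functional. -/
noncomputable def evalCLM (w : ℂ) : StrongDual ℂ FockSpace :=
  LinearMap.mkContinuous ⟨⟨fun f => f w, fun _ _ => rfl⟩, fun _ _ => rfl⟩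
    (Real.exp ((‖w‖ + 1) ^ 2)) fun f => norm_apply_le f w

theorem evalCLM_apply (w : ℂ) (f : FockSpace) : evalCLM w f = f w := rfl

/-- Cauchy's estimate on the unit circle about `w`, where `‖z‖ + 1 ≤ ‖w‖ + 2`. -/
theorem norm_deriv_le (f : FockSpace) (w : ℂ) :
    ‖deriv f w‖ ≤ Real.exp ((‖w‖ + 2) ^ 2) * ‖f‖ := by
  have := Complex.norm_deriv_le_of_forall_mem_sphere_norm_le (f := f) (c := w) (R := 1)
    (C := Real.exp ((‖w‖ + 2) ^ 2) * ‖f‖) one_pos f.differentiable.diffContOnCl (by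
      intro z hz
      have hz' : ‖z‖ ≤ ‖w‖ + 1 := by
        have h1 : ‖z - w‖ = 1 := by simpa [dist_eq_norm] using hz
        linarith [norm_le_norm_add_norm_sub' z w]
      refine (norm_apply_le f z).trans (mul_le_mul_of_nonneg_right (Real.exp_le_exp.2 ?_)
        (norm_nonneg _))
      exact pow_le_pow_left₀ (by positivity) (by linarith) 2)
  simpa using this

/-- Evaluation of the derivative as a bounded functional. -/
noncomputable def derivCLM (w : ℂ) : StrongDual ℂ FockSpace :=
  LinearMap.mkContinuous
    ⟨⟨fun f => deriv f w, fun f g => deriv_add (f.differentiable w) (g.differentiable w)⟩,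
      fun r f => deriv_const_mul r (f.differentiable w)⟩
    (Real.exp ((‖w‖ + 2) ^ 2)) fun f => norm_deriv_le f w

theorem derivCLM_apply (w : ℂ) (f : FockSpace) : derivCLM w f = deriv f w := rfl

/-- The reproducing kernel. -/
noncomputable def kernel (w : ℂ) : FockSpace :=
  (InnerProductSpace.toDual ℂ FockSpace).symm (evalCLM w)

theorem inner_kernel (w : ℂ) (f : FockSpace) : inner ℂ (kernel w) f = f w := by
  rw [kernel, InnerProductSpace.toDual_symm_apply, evalCLM_apply]

/-- The element of the Fock space representing the evaluation of the derivative. -/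
noncomputable def derivKernel (w : ℂ) : FockSpace :=
  (InnerProductSpace.toDual ℂ FockSpace).symm (derivCLM w)

theorem inner_derivKernel (w : ℂ) (f : FockSpace) :
    inner ℂ (derivKernel w) f = deriv f w := by
  rw [derivKernel, InnerProductSpace.toDual_symm_apply, derivCLM_apply]

/-- The kernel comes from Riesz representation; pairing it with the monomials reads off its Taylor
coefficients `conj w ^ n`. -/
theorem kernel_apply (w z : ℂ) : kernel w z = exp (conj w * z) := by
  have h1 : ∀ n, iteratedDeriv n (kernel w) 0 = conj w ^ n := fun n => by
    rw [← inner_monomial, ← inner_conj_symm, inner_kernel, monomial_apply, map_pow]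
  have h2 := hasSum_taylorSeries_of_entire (kernel w).differentiable 0 z
  have h3 := hasSum_taylorSeries_of_entire
    (f := fun z => exp (conj w * z)) (by fun_prop) 0 z
  simp only [h1] at h2
  simp only [iteratedDeriv_cexp_const_mul, mul_zero, exp_zero, mul_one] at h3
  exact h2.unique h3

theorem derivKernel_apply (w z : ℂ) : derivKernel w z = z * exp (conj w * z) := by
  rw [← inner_kernel, ← inner_conj_symm, inner_derivKernel]
  have h1 : (kernel z : ℂ → ℂ) = fun x => exp (conj z * x) := funext (kernel_apply z)
  have h2 : HasDerivAt (fun x => exp (conj z * x)) (exp (conj z * w) * (conj z * 1)) w :=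
    ((hasDerivAt_id w).const_mul (conj z)).cexp
  rw [h1, h2.deriv]
  simp only [map_mul, mul_one, conj_conj, ← exp_conj]
  rw [mul_comm, mul_comm z (conj w)]

/-- Parseval for the normalized monomials, with the two factors `1/√(n!)` merged. -/
theorem hasSum_inner (g f : FockSpace) :
    HasSum (fun n => conj (iteratedDeriv n g 0) * iteratedDeriv n f 0 / (n.factorial : ℂ))
      (inner ℂ g f) := by
  have h := hilbertBasis.hasSum_inner_mul_inner g f
  refine h.congr_fun ?_
  intro n
  rw [hilbertBasis_apply, ← inner_conj_symm, inner_onb, inner_onb, map_mul, map_inv₀, conj_ofReal]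
  have h0 : (0 : ℝ) < n.factorial := by exact_mod_cast n.factorial_pos
  have h1 : ((Real.sqrt n.factorial : ℝ) : ℂ) ≠ 0 :=
    ofReal_ne_zero.2 (Real.sqrt_pos.2 h0).ne'
  have h2 : (n.factorial : ℂ) = (Real.sqrt n.factorial : ℝ) * ((Real.sqrt n.factorial : ℝ) : ℂ) := by
    rw [← ofReal_mul, Real.mul_self_sqrt h0.le]; simp
  rw [h2]
  field_simp

theorem norm_iteratedDeriv (n : ℕ) (f : FockSpace) :
    ‖iteratedDeriv n f 0‖ = Real.sqrt n.factorial * ‖inner ℂ (onb n) f‖ := by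
  have h0 : (0 : ℝ) < n.factorial := by exact_mod_cast n.factorial_pos
  have h1 := Real.sqrt_pos.2 h0
  rw [inner_onb, norm_mul, norm_inv, norm_real, Real.norm_of_nonneg h1.le]
  field_simp

end FockSpace

/-! ### Formal adjointness on maximal domains. -/

theorem iteratedDeriv_id_mul (n : ℕ) {f : ℂ → ℂ} (hf : Differentiable ℂ f) :
    iteratedDeriv n (fun z => z * f z) 0 = n * iteratedDeriv (n - 1) f 0 := by
  -- At `n = 0` the truncated index `n - 1` is harmless, since the factor `n` kills the term.
  induction n generalizing f with
  | zero => simp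
  | succ n ih =>
    have hd : Differentiable ℂ (deriv f) := hf.contDiff.differentiable_deriv_two
    have h1 : deriv (fun z => z * f z) = f + fun z => z * deriv f z := by
      funext z
      have : HasDerivAt (fun z => z * f z) (1 * f z + z * deriv f z) z :=
        (hasDerivAt_id z).mul (hf z).hasDerivAt
      rw [this.deriv]; simp
    have h2 : Differentiable ℂ fun z => z * deriv f z := differentiable_id.mul hd
    rw [iteratedDeriv_succ', h1, iteratedDeriv_add hf.contDiff.contDiffAt
      h2.contDiff.contDiffAt, ih hd]
    cases n with
    | zero => simp
    | succ n =>
      simp only [Nat.add_sub_cancel, ← iteratedDeriv_succ']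
      push_cast; ring

/-- The Taylor coefficients of a first order affine differential expression. -/
theorem iteratedDeriv_affine (α β γ δ : ℂ) (n : ℕ) {f : ℂ → ℂ} (hf : Differentiable ℂ f) :
    iteratedDeriv n (fun z => (α + β * z) * f z + (γ + δ * z) * deriv f z) 0
      = α * iteratedDeriv n f 0 + β * (n * iteratedDeriv (n - 1) f 0)
        + γ * iteratedDeriv (n + 1) f 0 + δ * (n * iteratedDeriv n f 0) := by
  have hd : Differentiable ℂ (deriv f) := hf.contDiff.differentiable_deriv_two
  have h1 : (fun z => (α + β * z) * f z + (γ + δ * z) * deriv f z)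
      = α • f + β • (fun z => z * f z) + γ • deriv f + δ • fun z => z * deriv f z := by
    funext z
    simp only [Pi.add_apply, Pi.smul_apply, smul_eq_mul]
    ring
  have d2 : Differentiable ℂ fun z => z * f z := differentiable_id.mul hf
  have d4 : Differentiable ℂ fun z => z * deriv f z := differentiable_id.mul hd
  have c1 := (hf.const_smul α).contDiff.contDiffAt (n := n) (x := 0)
  have c2 := (d2.const_smul β).contDiff.contDiffAt (n := n) (x := 0)
  have c3 := (hd.const_smul γ).contDiff.contDiffAt (n := n) (x := 0)
  have c4 := (d4.const_smul δ).contDiff.contDiffAt (n := n) (x := 0)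
  have e := iteratedDeriv_id_mul n hd
  have e' : (n : ℂ) * iteratedDeriv (n - 1) (deriv f) 0 = n * iteratedDeriv n f 0 := by
    cases n with
    | zero => simp
    | succ n => simp only [Nat.add_sub_cancel, ← iteratedDeriv_succ']
  have c12 : ContDiffAt ℂ n (α • f + β • fun z => z * f z) 0 := c1.add c2
  have c123 : ContDiffAt ℂ n ((α • f + β • fun z => z * f z) + γ • deriv f) 0 := c12.add c3
  rw [h1, iteratedDeriv_add c123 c4, iteratedDeriv_add c12 c3, iteratedDeriv_add c1 c2]
  simp only [iteratedDeriv_const_smul_field, smul_eq_mul]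
  rw [iteratedDeriv_id_mul n hf, e, e', iteratedDeriv_succ']

/-- A nonzero limit would give `y n ≥ const / (n + 1)` eventually, against divergence of the
harmonic series. The crude bound `√(n+1) ≤ n+1` suffices. -/
theorem eq_zero_of_tendsto_of_norm_le_sqrt_mul {s : ℕ → ℂ} {L : ℂ} (hs : Tendsto s atTop (𝓝 L))
    {y : ℕ → ℝ} (hy : Summable y) (h : ∀ n : ℕ, ‖s n‖ ≤ Real.sqrt (n + 1) * y n) : L = 0 := by
  by_contra hL
  have hL' : 0 < ‖L‖ := norm_pos_iff.2 hL
  have h1 : ∀ᶠ n in atTop, ‖L‖ / 2 < ‖s n‖ :=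
    hs.norm.eventually (lt_mem_nhds (by linarith))
  have h2 : Summable fun n : ℕ => 1 / ((n : ℝ) + 1) := by
    refine Summable.of_norm_bounded_eventually_nat (g := fun n => 2 / ‖L‖ * y n)
      (hy.mul_left _) ?_
    filter_upwards [h1] with n hn
    have h3 : Real.sqrt (n + 1) ≤ n + 1 :=
      Real.sqrt_le_iff.2 ⟨by positivity, by nlinarith [(Nat.cast_nonneg n : (0 : ℝ) ≤ n)]⟩
    have h4 : (0 : ℝ) < n + 1 := by positivity
    have h5 := hn.trans_le (h n)
    have h6 : 0 ≤ y n := by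
      have := Real.sqrt_pos.2 h4
      by_contra hneg
      nlinarith
    have h7 : ‖L‖ / 2 ≤ (n + 1) * y n := h5.le.trans (by gcongr)
    rw [Real.norm_of_nonneg (by positivity), div_le_iff₀ h4, div_mul_eq_mul_div, div_mul_eq_mul_div,
      le_div_iff₀ hL']
    linarith
  have h3 : Summable fun n : ℕ => 1 / (n : ℝ) := by
    rw [← summable_nat_add_iff 1]
    exact_mod_cast h2
  exact Real.not_summable_one_div_natCast h3

namespace FockSpace

/-- Controls the boundary term of the telescoping sum: normalizing neighbouring coefficients costs
`√((n+1)!) √(n!) / n! = √(n+1)`, and the remaining product is bounded by squares, which are summable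
by Bessel. -/
theorem norm_conj_iteratedDeriv_mul_le (g f : FockSpace) (n : ℕ) :
    ‖conj (iteratedDeriv (n + 1) g 0) * iteratedDeriv n f 0 / (n.factorial : ℂ)‖
      ≤ Real.sqrt (n + 1) * (‖inner ℂ (onb (n + 1)) g‖ ^ 2 + ‖inner ℂ (onb n) f‖ ^ 2) := by
  rw [norm_div, norm_mul, RCLike.norm_conj, norm_iteratedDeriv, norm_iteratedDeriv,
    RCLike.norm_natCast, Nat.factorial_succ, Nat.cast_mul, Real.sqrt_mul (by positivity)]
  have h0 : (0 : ℝ) < n.factorial := by exact_mod_cast n.factorial_pos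
  have h1 := Real.mul_self_sqrt h0.le
  set G := ‖inner ℂ (onb (n + 1)) g‖
  set F := ‖inner ℂ (onb n) f‖
  rw [div_le_iff₀ h0]
  have h2 : Real.sqrt ((n + 1 : ℕ) : ℝ) * Real.sqrt n.factorial * G * (Real.sqrt n.factorial * F)
      = Real.sqrt (n + 1) * (G * F) * n.factorial := by
    push_cast
    linear_combination Real.sqrt (n + 1) * G * F * h1
  rw [h2]
  gcongr
  nlinarith [sq_nonneg (G - F), sq_nonneg (G + F)]

/-- The maximal first order operator with affine coefficients and the maximal operator of the
formally adjoint expression are formally adjoint to each other. -/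
theorem inner_eq_inner_of_affine {α β γ δ : ℂ} {f g hf hg : FockSpace}
    (h1 : ∀ z, hf z = (α + β * z) * f z + (γ + δ * z) * deriv f z)
    (h2 : ∀ z, hg z = (conj α + conj γ * z) * g z + (conj β + conj δ * z) * deriv g z) :
    inner ℂ hg f = inner ℂ g hf := by
  have e1 := fun n => iteratedDeriv_affine α β γ δ n f.differentiable
  have e2 := fun n => iteratedDeriv_affine (conj α) (conj γ) (conj β) (conj δ) n g.differentiable
  rw [← (funext h1 : (hf : ℂ → ℂ) = _)] at e1
  rw [← (funext h2 : (hg : ℂ → ℂ) = _)] at e2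
  have hs := ((hasSum_inner hg f).sub (hasSum_inner g hf)).tendsto_sum_nat
  have hs' := (tendsto_add_atTop_iff_nat 1).2 hs
  -- The `α` and `δ` terms cancel for each `n`. The `β` and `γ` terms shift the index by one, so
  -- they telescope and leave only the contribution linking `N` and `N + 1`.
  have key : ∀ N : ℕ, ∑ n ∈ Finset.range (N + 1),
      (conj (iteratedDeriv n hg 0) * iteratedDeriv n f 0 / (n.factorial : ℂ)
        - conj (iteratedDeriv n g 0) * iteratedDeriv n hf 0 / (n.factorial : ℂ))
      = β * (conj (iteratedDeriv (N + 1) g 0) * iteratedDeriv N f 0 / (N.factorial : ℂ))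
        - γ * conj (conj (iteratedDeriv (N + 1) f 0) * iteratedDeriv N g 0
          / (N.factorial : ℂ)) := by
    intro N
    induction N with
    | zero =>
      simp only [zero_add, Finset.sum_range_one, e1, e2, map_add, map_mul, conj_conj, map_div₀,
        map_natCast]
      simp only [Nat.factorial_zero, Nat.cast_zero, Nat.cast_one]
      ring
    | succ N ih =>
      rw [Finset.sum_range_succ, ih]
      simp only [e1, e2, map_add, map_mul, conj_conj, map_div₀, map_natCast, Nat.add_sub_cancel,
        Nat.factorial_succ, Nat.cast_mul]
      have h3 : ((N + 1 : ℕ) : ℂ) ≠ 0 := by exact_mod_cast N.succ_ne_zero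
      have h4 : (N.factorial : ℂ) ≠ 0 := by exact_mod_cast N.factorial_ne_zero
      field_simp
      ring
  simp only [key] at hs'
  have sg := orthonormal_onb.inner_products_summable g
  have sf := orthonormal_onb.inner_products_summable f
  have sg' := (summable_nat_add_iff 1).2 sg
  have sf' := (summable_nat_add_iff 1).2 sf
  refine sub_eq_zero.1 (eq_zero_of_tendsto_of_norm_le_sqrt_mul hs'
    (((sg'.add sf).mul_left ‖β‖).add ((sf'.add sg).mul_left ‖γ‖)) fun n => ?_)
  refine (norm_sub_le _ _).trans ?_
  rw [norm_mul, norm_mul, RCLike.norm_conj]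
  have b1 := norm_conj_iteratedDeriv_mul_le g f n
  have b2 := norm_conj_iteratedDeriv_mul_le f g n
  rw [mul_add, mul_left_comm _ ‖β‖, mul_left_comm _ ‖γ‖]
  exact add_le_add (mul_le_mul_of_nonneg_left b1 (norm_nonneg _))
    (mul_le_mul_of_nonneg_left b2 (norm_nonneg _))

end FockSpace

/-! ### Adjoints, conjugates and the maximal operator through their graphs. -/

namespace LinearPMap

variable {H : Type*} [NormedAddCommGroup H] [InnerProductSpace ℂ H] [CompleteSpace H]

/-- Handles domain and value together, so that equalities of unbounded operators become pointwise
equivalences without dependent subtypes. -/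
theorem mem_graph_adjoint_iff {T : H →ₗ.[ℂ] H} (hT : Dense (T.domain : Set H)) {y w : H} :
    (y, w) ∈ T.adjoint.graph ↔ ∀ x u : H, (x, u) ∈ T.graph → inner ℂ w x = inner ℂ y u := by
  constructor
  · intro h x u hx
    obtain ⟨y', hy, hw⟩ := (mem_graph_iff _).1 h
    obtain ⟨x', hx, hu⟩ := (mem_graph_iff _).1 hx
    simp only at hy hw hx hu
    rw [← hy, ← hw, ← hx, ← hu]
    exact adjoint_isFormalAdjoint hT y' x'
  · intro h
    have h' : ∀ x : T.domain, inner ℂ w (x : H) = inner ℂ y (T x) := fun x =>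
      h _ _ (T.mem_graph x)
    have hy : y ∈ T.adjoint.domain := mem_adjoint_domain_of_exists y ⟨w, h'⟩
    exact (mem_graph_iff _).2 ⟨⟨y, hy⟩, rfl, adjoint_apply_eq hT ⟨y, hy⟩ h'⟩

end LinearPMap

namespace Conjugation

variable {H : Type*} [NormedAddCommGroup H] [InnerProductSpace ℂ H]

theorem apply_apply (C : Conjugation H) (x : H) : C.toLinearMap (C.toLinearMap x) = x :=
  C.involutive' x

theorem mem_graph_conjugate_iff (C : Conjugation H) (A : H →ₗ.[ℂ] H) {f g : H} :
    (f, g) ∈ (C.conjugate A).graph ↔ (C.toLinearMap f, C.toLinearMap g) ∈ A.graph := by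
  simp only [LinearPMap.mem_graph_iff]
  constructor
  · rintro ⟨f', rfl, rfl⟩
    exact ⟨⟨C.toLinearMap f', f'.2⟩, rfl, (C.apply_apply _).symm⟩
  · rintro ⟨y, hy, hg⟩
    obtain ⟨y, hy'⟩ := y
    simp only at hy hg
    subst hy
    refine ⟨⟨f, hy'⟩, rfl, ?_⟩
    rw [← C.apply_apply g, ← hg]
    rfl

end Conjugation

theorem diffExpr_pair (ψ₀ ψ₁ f : ℂ → ℂ) (z : ℂ) :
    diffExpr ![ψ₀, ψ₁] f z = ψ₀ z * f z + ψ₁ z * deriv f z := by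
  simp [diffExpr, Fin.sum_univ_two]

theorem mem_graph_maximalOperator_iff {ψ₀ ψ₁ : ℂ → ℂ} {f g : FockSpace} :
    (f, g) ∈ (maximalOperator ![ψ₀, ψ₁]).graph ↔
      ∀ z, g z = ψ₀ z * f z + ψ₁ z * deriv f z := by
  simp only [LinearPMap.mem_graph_iff, ← diffExpr_pair]
  constructor
  · rintro ⟨f', rfl, rfl⟩ z
    exact maximalOperator_apply _ f' z
  · intro h
    refine ⟨⟨f, g, h⟩, rfl, ?_⟩
    ext z
    rw [maximalOperator_apply, h]

/-- Evaluations of `f` and `f'` at a point are bounded, so the graph is cut out by one closed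
condition for each `z`. -/
theorem isClosed_maximalOperator (ψ₀ ψ₁ : ℂ → ℂ) :
    (maximalOperator ![ψ₀, ψ₁]).IsClosed := by
  have h : ((maximalOperator ![ψ₀, ψ₁]).graph : Set (FockSpace × FockSpace))
      = ⋂ z, {p | FockSpace.evalCLM z p.2
        = ψ₀ z * FockSpace.evalCLM z p.1 + ψ₁ z * FockSpace.derivCLM z p.1} := by
    ext ⟨f, g⟩
    simp only [SetLike.mem_coe, mem_graph_maximalOperator_iff, Set.mem_iInter, Set.mem_ofPred_eq,
      FockSpace.evalCLM_apply, FockSpace.derivCLM_apply]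
  rw [LinearPMap.IsClosed, h]
  exact isClosed_iInter fun z => isClosed_eq (by fun_prop) (by fun_prop)

theorem FockSpace.deriv_kernel (w z : ℂ) : deriv (kernel w) z = conj w * kernel w z := by
  have h1 : (kernel w : ℂ → ℂ) = fun x => exp (conj w * x) := funext (kernel_apply w)
  have h2 : HasDerivAt (fun x => exp (conj w * x)) (exp (conj w * z) * (conj w * 1)) z :=
    ((hasDerivAt_id z).const_mul (conj w)).cexp
  rw [kernel_apply, h1, h2.deriv]
  ring

/-! ### The adjoint for affine coefficients. -/

section Affine

variable {ψ₀ ψ₁ : ℂ → ℂ} {p₀ p₁ q₀ q₁ : ℂ}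

/-- Differentiating a kernel multiplies it by `conj w`, and multiplying it by `z` gives `derivKernel
w`; hence affine coefficients keep kernels in the domain. -/
theorem kernel_mem_graph_maximalOperator (h₀ : ∀ z, ψ₀ z = p₀ + p₁ * z)
    (h₁ : ∀ z, ψ₁ z = q₀ + q₁ * z) (w : ℂ) :
    (FockSpace.kernel w, (p₀ + q₀ * conj w) • FockSpace.kernel w
      + (p₁ + q₁ * conj w) • FockSpace.derivKernel w) ∈ (maximalOperator ![ψ₀, ψ₁]).graph := by
  rw [mem_graph_maximalOperator_iff]
  intro z
  rw [FockSpace.deriv_kernel, FockSpace.add_apply, FockSpace.smul_apply, FockSpace.smul_apply,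
    FockSpace.kernel_apply, FockSpace.derivKernel_apply, h₀, h₁]
  ring

theorem dense_domain_maximalOperator (h₀ : ∀ z, ψ₀ z = p₀ + p₁ * z)
    (h₁ : ∀ z, ψ₁ z = q₀ + q₁ * z) :
    Dense ((maximalOperator ![ψ₀, ψ₁]).domain : Set FockSpace) := by
  rw [Submodule.dense_iff_topologicalClosure_eq_top, Submodule.topologicalClosure_eq_top_iff,
    Submodule.eq_bot_iff]
  intro f hf
  ext w
  rw [← FockSpace.inner_kernel]
  exact (Submodule.mem_orthogonal _ _).1 hf _
    (LinearPMap.mem_domain_of_mem_graph (kernel_mem_graph_maximalOperator h₀ h₁ w))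

/-- The adjoint of the maximal operator with affine coefficients is the maximal operator of the
formally adjoint expression. -/
theorem mem_graph_adjoint_maximalOperator_iff (h₀ : ∀ z, ψ₀ z = p₀ + p₁ * z)
    (h₁ : ∀ z, ψ₁ z = q₀ + q₁ * z) {f g : FockSpace} :
    (f, g) ∈ (maximalOperator ![ψ₀, ψ₁]).adjoint.graph ↔
      ∀ z, g z = (conj p₀ + conj q₀ * z) * f z + (conj p₁ + conj q₁ * z) * deriv f z := by
  rw [LinearPMap.mem_graph_adjoint_iff (dense_domain_maximalOperator h₀ h₁)]
  constructor
  · intro h z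
    -- Testing the adjoint relation on the kernel at `z` recovers `g z`, up to complex conjugation.
    have h2 := h _ _ (kernel_mem_graph_maximalOperator h₀ h₁ z)
    rw [← inner_conj_symm, FockSpace.inner_kernel, inner_add_right, inner_smul_right,
      inner_smul_right, ← inner_conj_symm f, FockSpace.inner_kernel, ← inner_conj_symm f,
      FockSpace.inner_derivKernel] at h2
    have h3 := congrArg conj h2
    simp only [map_add, map_mul, conj_conj] at h3
    exact h3
  · intro h x u hx
    rw [mem_graph_maximalOperator_iff] at hx
    simp only [h₀, h₁] at hx
    exact FockSpace.inner_eq_inner_of_affine hx h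

end Affine

/-! ### Conjugation symmetry and rigidity of the coefficients. -/

section WeightedConjugation

variable {a b c : ℂ}

theorem IsConjugationParam.a_ne_zero (h : IsConjugationParam a b c) : a ≠ 0 := by
  rw [← norm_ne_zero_iff, h.norm_a]; exact one_ne_zero

theorem IsConjugationParam.c_ne_zero (h : IsConjugationParam a b c) : c ≠ 0 := by
  rintro rfl
  simpa using h.c_b

theorem deriv_weightedConjugation (h : IsConjugationParam a b c) (f : FockSpace) (z : ℂ) :
    deriv ((weightedConjugation h).toLinearMap f) z
      = c * exp (b * z) * (b * conj (f (conj (a * z + b)))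
        + a * conj (deriv f (conj (a * z + b)))) := by
  have h0 : ((weightedConjugation h).toLinearMap f : ℂ → ℂ)
      = fun z => c * exp (b * z) * (conj ∘ f ∘ conj) (a * z + b) :=
    funext fun z => weightedConjugation_apply h f z
  have h1 : HasDerivAt (conj ∘ f ∘ conj) (conj (deriv f (conj (a * z + b)))) (a * z + b) :=
    hasDerivAt_conj_conj_iff.2 (by simpa using (f.differentiable _).hasDerivAt)
  have h2 : HasDerivAt (fun z => a * z + b) a z := by
    simpa using ((hasDerivAt_id z).const_mul a).add_const b
  have h3 : HasDerivAt (fun z => c * exp (b * z)) (c * (exp (b * z) * (b * 1))) z :=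
    (((hasDerivAt_id z).const_mul b).cexp).const_mul c
  have h4 : HasDerivAt (fun z => c * exp (b * z) * (conj ∘ f ∘ conj) (a * z + b))
      (c * (exp (b * z) * (b * 1)) * (conj ∘ f ∘ conj) (a * z + b)
        + c * exp (b * z) * (conj (deriv f (conj (a * z + b))) * a)) z :=
    h3.mul (HasDerivAt.comp (h₂ := conj ∘ f ∘ conj) z h1 h2)
  rw [h0, h4.deriv]
  simp only [Function.comp_apply]
  ring

theorem weightedConjugation_kernel (h : IsConjugationParam a b c) (w z : ℂ) :
    (weightedConjugation h).toLinearMap (FockSpace.kernel w) z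
      = c * exp (b * z) * exp (w * (a * z + b)) := by
  rw [weightedConjugation_apply, FockSpace.kernel_apply, ← exp_conj]
  simp only [map_mul, conj_conj]

theorem weightedConjugation_derivKernel (h : IsConjugationParam a b c) (w z : ℂ) :
    (weightedConjugation h).toLinearMap (FockSpace.derivKernel w) z
      = (a * z + b) * (c * exp (b * z) * exp (w * (a * z + b))) := by
  rw [weightedConjugation_apply, FockSpace.derivKernel_apply, map_mul, ← exp_conj]
  simp only [map_mul, conj_conj]
  ring

/-- The formally adjoint equation for `C f`, `C g` at `z` is the original equation for `f`, `g` at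
`conj (a z + b)`, conjugated and multiplied by a nonzero weight. Since `z ↦ conj (a z + b)` is an
involution, the two families of equations agree. -/
theorem maximalOperator_eq_conjugate_adjoint (h : IsConjugationParam a b c) {ψ₀ ψ₁ : ℂ → ℂ}
    {d₀₀ d₀₁ d₁₁ : ℂ} (h₀ : ∀ z, ψ₀ z = d₀₀ + d₀₁ * (a * z + b))
    (h₁ : ∀ z, ψ₁ z = d₀₁ + d₁₁ * (a * z + b)) :
    maximalOperator ![ψ₀, ψ₁]
      = (weightedConjugation h).conjugate (maximalOperator ![ψ₀, ψ₁]).adjoint := by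
  have h₀' : ∀ z, ψ₀ z = (d₀₀ + d₀₁ * b) + (d₀₁ * a) * z := fun z => by rw [h₀]; ring
  have h₁' : ∀ z, ψ₁ z = (d₀₁ + d₁₁ * b) + (d₁₁ * a) * z := fun z => by rw [h₁]; ring
  refine LinearPMap.eq_of_eq_graph (SetLike.ext fun ⟨f, g⟩ => ?_)
  rw [Conjugation.mem_graph_conjugate_iff, mem_graph_adjoint_maximalOperator_iff h₀' h₁',
    mem_graph_maximalOperator_iff]
  have key : ∀ z, (weightedConjugation h).toLinearMap g z
        = (conj (d₀₀ + d₀₁ * b) + conj (d₀₁ + d₁₁ * b) * z) *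
            (weightedConjugation h).toLinearMap f z
          + (conj (d₀₁ * a) + conj (d₁₁ * a) * z) *
            deriv ((weightedConjugation h).toLinearMap f) z ↔
      g (conj (a * z + b)) = ψ₀ (conj (a * z + b)) * f (conj (a * z + b))
        + ψ₁ (conj (a * z + b)) * deriv f (conj (a * z + b)) := by
    intro z
    have hne : c * exp (b * z) ≠ 0 := mul_ne_zero h.c_ne_zero (exp_ne_zero _)
    have e1 := h.a_mul_conj
    have e2 := h.ab
    have e3 : (conj (d₀₀ + d₀₁ * b) + conj (d₀₁ + d₁₁ * b) * z) *
            (weightedConjugation h).toLinearMap f z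
          + (conj (d₀₁ * a) + conj (d₁₁ * a) * z) *
            deriv ((weightedConjugation h).toLinearMap f) z
        = c * exp (b * z) * conj (ψ₀ (conj (a * z + b)) * f (conj (a * z + b))
        + ψ₁ (conj (a * z + b)) * deriv f (conj (a * z + b))) := by
      rw [deriv_weightedConjugation, weightedConjugation_apply, h₀', h₁']
      simp only [map_add, map_mul, conj_conj]
      generalize conj (f _) = F
      generalize conj (deriv f _) = F'
      -- The `d₀₁` terms match by `a * conj a = 1`, the `d₁₁` terms by `conj a * b + conj b = 0`.
      linear_combination c * exp (b * z) * (F' - z * F) * conj d₀₁ * e1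
        + c * exp (b * z) * (z * F - F') * conj d₁₁ * e2
    rw [e3, weightedConjugation_apply, mul_right_inj' hne, (RingHom.injective _).eq_iff]
  simp only [key]
  exact ⟨fun H z => H _, fun H z => by simpa only [h.affine_affine] using H (conj (a * z + b))⟩

theorem isCSelfadjoint_maximalOperator (h : IsConjugationParam a b c) {ψ₀ ψ₁ : ℂ → ℂ}
    {d₀₀ d₀₁ d₁₁ : ℂ} (h₀ : ∀ z, ψ₀ z = d₀₀ + d₀₁ * (a * z + b))
    (h₁ : ∀ z, ψ₁ z = d₀₁ + d₁₁ * (a * z + b)) :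
    IsCSelfadjoint (weightedConjugation h) (maximalOperator ![ψ₀, ψ₁]) := by
  have h₀' : ∀ z, ψ₀ z = (d₀₀ + d₀₁ * b) + (d₀₁ * a) * z := fun z => by rw [h₀]; ring
  have h₁' : ∀ z, ψ₁ z = (d₀₁ + d₁₁ * b) + (d₁₁ * a) * z := fun z => by rw [h₁]; ring
  exact ⟨isClosed_maximalOperator _ _, dense_domain_maximalOperator h₀' h₁',
    maximalOperator_eq_conjugate_adjoint h h₀ h₁⟩

/-- The symmetry that `C`-selfadjointness forces on the coefficients. -/
theorem IsCSelfadjoint.symm_coeff {h : IsConjugationParam a b c} {ψ₀ ψ₁ : ℂ → ℂ}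
    {T : FockSpace →ₗ.[ℂ] FockSpace} (hT : T ≤ maximalOperator ![ψ₀, ψ₁])
    (hs : IsCSelfadjoint (weightedConjugation h) T) (z x : ℂ) :
    ψ₀ z + ψ₁ z * (a * x + b) = ψ₀ x + ψ₁ x * (a * z + b) := by
  obtain ⟨-, hd, he⟩ := hs
  -- Kernels lie in the domain of the adjoint for arbitrary coefficients, as `ψ₀` and `ψ₁` enter
  -- only through their values at `z`.
  have h1 : (FockSpace.kernel z, conj (ψ₀ z) • FockSpace.kernel z
      + conj (ψ₁ z) • FockSpace.derivKernel z) ∈ T.adjoint.graph := by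
    rw [LinearPMap.mem_graph_adjoint_iff hd]
    intro y u hy
    have hy' := mem_graph_maximalOperator_iff.1 (LinearPMap.le_graph_of_le hT hy)
    rw [inner_add_left, inner_smul_left, inner_smul_left, FockSpace.inner_kernel,
      FockSpace.inner_kernel, FockSpace.inner_derivKernel, conj_conj, conj_conj, hy']
  -- Involutivity of `C` moves this pair from the graph of `T*` to that of `T`, where the action is
  -- the explicit differential expression.
  have h2 : ((weightedConjugation h).toLinearMap (FockSpace.kernel z),
      (weightedConjugation h).toLinearMap (conj (ψ₀ z) • FockSpace.kernel z
      + conj (ψ₁ z) • FockSpace.derivKernel z)) ∈ T.graph := by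
    rw [he, Conjugation.mem_graph_conjugate_iff, Conjugation.apply_apply, Conjugation.apply_apply]
    exact h1
  have h3 := mem_graph_maximalOperator_iff.1 (LinearPMap.le_graph_of_le hT h2) x
  rw [map_add, map_smulₛₗ, map_smulₛₗ, FockSpace.add_apply, FockSpace.smul_apply,
    FockSpace.smul_apply, deriv_weightedConjugation, weightedConjugation_kernel,
    weightedConjugation_derivKernel, conj_conj, conj_conj, FockSpace.deriv_kernel,
    FockSpace.kernel_apply] at h3
  simp only [map_mul, ← exp_conj, conj_conj] at h3
  have hne : c * exp (b * x) * exp (z * (a * x + b)) ≠ 0 :=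
    mul_ne_zero (mul_ne_zero h.c_ne_zero (exp_ne_zero _)) (exp_ne_zero _)
  refine mul_left_cancel₀ hne ?_
  linear_combination h3

/-- In the symmetry relation, take `x` with `a x + b = 0` to get `ψ₀`, then `x` with `a x + b = 1`
to get `ψ₁`. The slope of `ψ₀` is the value of `ψ₁` at the first point, whence the shared constant
`d₀₁`. -/
theorem IsCSelfadjoint.exists_affine {h : IsConjugationParam a b c} {ψ₀ ψ₁ : ℂ → ℂ}
    {T : FockSpace →ₗ.[ℂ] FockSpace} (hT : T ≤ maximalOperator ![ψ₀, ψ₁])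
    (hs : IsCSelfadjoint (weightedConjugation h) T) :
    ∃ d₀₀ d₀₁ d₁₁ : ℂ, (∀ z, ψ₀ z = d₀₀ + d₀₁ * (a * z + b)) ∧
      ∀ z, ψ₁ z = d₀₁ + d₁₁ * (a * z + b) := by
  have ha := h.a_ne_zero
  have e0 : a * (-b / a) + b = 0 := by field_simp; ring
  have e1 : a * ((1 - b) / a) + b = 1 := by field_simp; ring
  have h0 : ∀ z, ψ₀ z = ψ₀ (-b / a) + ψ₁ (-b / a) * (a * z + b) := fun z => by
    have := hs.symm_coeff hT z (-b / a)
    rw [e0] at this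
    linear_combination this
  refine ⟨ψ₀ (-b / a), ψ₁ (-b / a), ψ₁ ((1 - b) / a) - ψ₁ (-b / a), h0, fun z => ?_⟩
  have h1 := hs.symm_coeff hT z ((1 - b) / a)
  have h2 := h0 ((1 - b) / a)
  rw [e1] at h1 h2
  linear_combination h1 - h0 z + h2

/-- From `T ≤ Tmax` follows `Tmax* ≤ T*`; conjugating by `C` gives `Tmax ≤ T`, since both operators
are `C`-selfadjoint. -/
theorem IsCSelfadjoint.eq_maximalOperator {h : IsConjugationParam a b c} {ψ₀ ψ₁ : ℂ → ℂ}
    {T : FockSpace →ₗ.[ℂ] FockSpace} (hT : T ≤ maximalOperator ![ψ₀, ψ₁])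
    (hs : IsCSelfadjoint (weightedConjugation h) T) : T = maximalOperator ![ψ₀, ψ₁] := by
  obtain ⟨d₀₀, d₀₁, d₁₁, h₀, h₁⟩ := hs.exists_affine hT
  have hm := isCSelfadjoint_maximalOperator h h₀ h₁
  refine le_antisymm hT (LinearPMap.le_of_le_graph ?_)
  rintro ⟨f, g⟩ hfg
  rw [hm.2.2, Conjugation.mem_graph_conjugate_iff, LinearPMap.mem_graph_adjoint_iff hm.2.1] at hfg
  rw [hs.2.2, Conjugation.mem_graph_conjugate_iff, LinearPMap.mem_graph_adjoint_iff hs.2.1]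
  exact fun x u hx => hfg x u (LinearPMap.le_graph_of_le hT hx)

end WeightedConjugation

/-! ### Eigenvalues and the eigenfunction equation. -/

theorem mem_pointSpectrum_maximalOperator_iff {ψ₀ ψ₁ : ℂ → ℂ} {μ : ℂ} :
    μ ∈ pointSpectrum (maximalOperator ![ψ₀, ψ₁]) ↔
      ∃ f : FockSpace, f ≠ 0 ∧ ∀ z, μ * f z = ψ₀ z * f z + ψ₁ z * deriv f z := by
  constructor
  · rintro ⟨f, hf, h⟩
    refine ⟨f, hf, fun z => ?_⟩
    have h1 := mem_graph_maximalOperator_iff.1 ((maximalOperator ![ψ₀, ψ₁]).mem_graph f) z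
    rwa [h] at h1
  · rintro ⟨f, hf, h⟩
    obtain ⟨f', h1, h2⟩ := (LinearPMap.mem_graph_iff _).1
      (mem_graph_maximalOperator_iff.2 h : (f, μ • f) ∈ (maximalOperator ![ψ₀, ψ₁]).graph)
    simp only at h1 h2
    subst h1
    exact ⟨f', hf, h2⟩

/-- An eigenvalue is determined by the order of vanishing of the eigenfunction at a simple zero
of the leading coefficient. -/
theorem exists_eigenvalue_eq_of_simple_zero {ψ₀ f : ℂ → ℂ} {w s μ : ℂ}
    (hψ₀ : Differentiable ℂ ψ₀) (hf : Differentiable ℂ f) (hne : ∃ z, f z ≠ 0)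
    (h : ∀ z, μ * f z = ψ₀ z * f z + s * (z - w) * deriv f z) :
    ∃ k : ℕ, ψ₀ w + k * s = μ := by
  have hfa : AnalyticOnNhd ℂ f Set.univ := fun z _ => hf.analyticAt z
  have hnt : ¬ ∀ᶠ z in 𝓝 w, f z = 0 := by
    intro h0
    obtain ⟨z, hz⟩ := hne
    exact hz (hfa.eqOn_zero_of_preconnected_of_eventuallyEq_zero isPreconnected_univ
      (Set.mem_univ w) h0 (Set.mem_univ z))
  obtain ⟨k, g, hg, hgw, hfg⟩ :=
    (hf.analyticAt w).exists_eventuallyEq_pow_smul_nonzero_iff.2 hnt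
  refine ⟨k, ?_⟩
  -- Substitute `f = (z - w)^k g` and cancel the power, which is possible only off `w`; the value at
  -- `w` is recovered below as a limit.
  have hev : ∀ᶠ z in 𝓝[≠] w, μ * g z = ψ₀ z * g z + s * (k * g z + (z - w) * deriv g z) := by
    have h1 := hfg.eventually_nhds.filter_mono (nhdsWithin_le_nhds (s := {w}ᶜ))
    have h2 := hg.eventually_analyticAt.filter_mono (nhdsWithin_le_nhds (s := {w}ᶜ))
    filter_upwards [h1, h2, self_mem_nhdsWithin] with z hz hgz hzw
    have hzw' : z - w ≠ 0 := sub_ne_zero.2 hzw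
    have h3 : HasDerivAt (fun z => (z - w) ^ k * g z)
        (k * (z - w) ^ (k - 1) * 1 * g z + (z - w) ^ k * deriv g z) z :=
      (((hasDerivAt_id z).sub_const w).pow k).mul hgz.differentiableAt.hasDerivAt
    have h4 : deriv f z = k * (z - w) ^ (k - 1) * 1 * g z + (z - w) ^ k * deriv g z :=
      (h3.congr_of_eventuallyEq hz).deriv
    have h5 : (z - w) * (k * (z - w) ^ (k - 1)) = k * (z - w) ^ k := by
      cases k with
      | zero => simp
      | succ k => rw [Nat.add_sub_cancel]; ring
    have h6 := h z
    rw [h4, hz.self_of_nhds, smul_eq_mul] at h6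
    refine mul_left_cancel₀ (pow_ne_zero k hzw') ?_
    linear_combination h6 + s * g z * h5
  have hc1 : Tendsto (fun z => μ * g z) (𝓝[≠] w) (𝓝 (μ * g w)) :=
    (continuousAt_const.mul hg.continuousAt).mono_left nhdsWithin_le_nhds
  have hc2 : Tendsto (fun z => ψ₀ z * g z + s * (k * g z + (z - w) * deriv g z)) (𝓝[≠] w)
      (𝓝 (ψ₀ w * g w + s * (k * g w + (w - w) * deriv g w))) := by
    have c1 := hψ₀.continuous.continuousAt (x := w)
    have c2 := hg.continuousAt
    have c3 := hg.deriv.continuousAt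
    have : ContinuousAt (fun z => ψ₀ z * g z + s * (k * g z + (z - w) * deriv g z)) w := by
      fun_prop
    exact this.mono_left nhdsWithin_le_nhds
  have h7 := tendsto_nhds_unique (hc1.congr' hev) hc2
  refine mul_right_cancel₀ hgw ?_
  linear_combination -h7

theorem FockSpace.powMulExp_ne_zero (w l : ℂ) (k : ℕ) : powMulExp w l k ≠ 0 := by
  intro h
  have := congrArg (fun f : FockSpace => f (w + 1)) h
  simp [powMulExp_apply, exp_ne_zero] at this

theorem FockSpace.deriv_powMulExp (w l : ℂ) (k : ℕ) (z : ℂ) :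
    (z - w) * deriv (powMulExp w l k) z = (k + (z - w) * l) * powMulExp w l k z := by
  have h1 : HasDerivAt (fun z => (z - w) ^ k * exp (l * z))
      (k * (z - w) ^ (k - 1) * 1 * exp (l * z) + (z - w) ^ k * (exp (l * z) * (l * 1))) z :=
    (((hasDerivAt_id z).sub_const w).pow k).mul ((hasDerivAt_id z).const_mul l).cexp
  have h2 : deriv (powMulExp w l k) z = _ := h1.deriv
  rw [h2, powMulExp_apply]
  have h5 : (z - w) * (k * (z - w) ^ (k - 1)) = k * (z - w) ^ k := by
    cases k with
    | zero => simp
    | succ k => rw [Nat.add_sub_cancel]; ring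
  linear_combination exp (l * z) * h5

/-! ### Gaussians of critical growth. -/

/-- A function which is integrable has small integrals over balls far away. -/
theorem tendsto_setIntegral_ball_of_integrable {g : ℂ → ℝ} (hg : Integrable g) {u : ℂ}
    (hu : ‖u‖ = 1) :
    Tendsto (fun n : ℕ => ∫ z in Metric.ball ((n : ℂ) * u) 1, g z) atTop (𝓝 0) := by
  have h1 : ∀ n : ℕ, ∫ z in Metric.ball ((n : ℂ) * u) 1, g z
      = ∫ z, (Metric.ball ((n : ℂ) * u) 1).indicator g z := fun n =>
    (integral_indicator Metric.isOpen_ball.measurableSet).symm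
  simp_rw [h1]
  rw [← integral_zero ℂ ℝ]
  refine tendsto_integral_of_dominated_convergence (fun z => ‖g z‖)
    (fun n => hg.aestronglyMeasurable.indicator Metric.isOpen_ball.measurableSet) hg.norm
    (fun n => Eventually.of_forall fun z => norm_indicator_le_norm_self _ _)
    (Eventually.of_forall fun z => ?_)
  refine tendsto_const_nhds.congr' ?_
  filter_upwards [eventually_ge_atTop (⌈‖z‖ + 1⌉₊)] with n hn
  have h2 : ‖z‖ + 1 ≤ n := Nat.ceil_le.1 hn
  rw [Set.indicator_of_notMem]
  intro hz
  have h3 : ‖(n : ℂ) * u - z‖ < 1 := by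
    simpa [dist_eq_norm, norm_sub_rev] using hz
  have h4 := norm_sub_norm_le ((n : ℂ) * u) z
  rw [norm_mul, hu, RCLike.norm_natCast] at h4
  linarith

/-- Each unit ball contributes at least `π ε`, although the contributions of an integrable function
along a ray tend to zero. -/
theorem not_integrable_of_le_on_balls {g : ℂ → ℝ} {u : ℂ} (hu : ‖u‖ = 1) {ε : ℝ} (hε : 0 < ε)
    (h : ∀ n : ℕ, ∀ z ∈ Metric.ball ((n : ℂ) * u) 1, ε ≤ g z) : ¬ Integrable g := by
  intro hg
  have h1 := tendsto_setIntegral_ball_of_integrable hg hu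
  have h2 : ∀ n : ℕ, Real.pi * ε ≤ ∫ z in Metric.ball ((n : ℂ) * u) 1, g z := by
    intro n
    have h3 : ∫ _ in Metric.ball ((n : ℂ) * u) 1, ε = Real.pi * ε := by
      simp [Measure.real, Complex.volume_ball]
    rw [← h3]
    exact setIntegral_mono_on (integrableOn_const (by simp [Complex.volume_ball]))
      hg.integrableOn Metric.isOpen_ball.measurableSet (h n)
  have := ge_of_tendsto' h1 h2
  have := mul_pos Real.pi_pos hε
  linarith

/-- Gaussians of critical growth are not in the Fock space. -/
theorem not_memLp_exp_quadratic {a : ℂ} (ha : ‖a‖ = 1) (l : ℂ) :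
    ¬ MemLp (fun z => exp (l * z - a * z ^ 2 / 2)) 2 fockMeasure := by
  -- Along `u` the quadratic exponential grows fastest and exactly balances the weight; the sign of
  -- `u` is chosen so that the linear factor does not decay.
  obtain ⟨u, hu2, hul⟩ : ∃ u : ℂ, a * u ^ 2 = -1 ∧ 0 ≤ (l * u).re := by
    obtain ⟨v, hv⟩ := IsAlgClosed.exists_pow_nat_eq (-a⁻¹) two_pos
    have ha0 : a ≠ 0 := by rw [← norm_ne_zero_iff, ha]; exact one_ne_zero
    have hv' : a * v ^ 2 = -1 := by rw [hv]; field_simp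
    rcases le_total 0 (l * v).re with h | h
    · exact ⟨v, hv', h⟩
    · exact ⟨-v, by rw [neg_sq, hv'], by rw [mul_neg, neg_re]; linarith⟩
  have hu : ‖u‖ = 1 := by
    have h1 := congrArg norm hu2
    rw [norm_mul, norm_pow, ha, one_mul, norm_neg, norm_one] at h1
    exact (pow_eq_one_iff_of_nonneg (norm_nonneg _) two_ne_zero).1 h1
  have huu : u * conj u = 1 := by rw [mul_conj, normSq_eq_norm_sq, hu]; simp
  have hau : a * u = -conj u := by linear_combination conj u * hu2 - a * u * huu
  intro hm
  rw [memLp_two_iff_integrable_sq_norm (by fun_prop), integrable_fockMeasure_iff] at hm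
  refine not_integrable_of_le_on_balls hu (ε := Real.exp (-(2 * ‖l‖) - 2) / Real.pi)
    (by positivity) (fun n z hz => ?_) hm
  obtain ⟨s, rfl⟩ : ∃ s, z = n * u + s := ⟨z - n * u, by ring⟩
  have hs : ‖s‖ ≤ 1 := by
    have : ‖s‖ < 1 := by simpa [dist_eq_norm] using hz
    exact this.le
  rw [smul_eq_mul, fockWeight, norm_exp, ← Real.exp_nat_mul, div_mul_eq_mul_div, ← Real.exp_add]
  refine div_le_div_of_nonneg_right (Real.exp_le_exp.2 ?_) Real.pi_pos.le
  -- The terms in `n²` and the cross terms `n s` cancel; what depends on `n` is only the nonnegative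
  -- `2 n Re(l u)`.
  have e1 : -‖n * u + s‖ ^ 2 + (2 : ℕ) * (l * (n * u + s) - a * (n * u + s) ^ 2 / 2).re
      = 2 * n * (l * u).re + 2 * (l * s).re - (a * s ^ 2).re - ‖s‖ ^ 2 := by
    rw [← ofReal_inj]
    have hau' := congrArg conj hau
    have hu2' := congrArg conj hu2
    push_cast
    simp only [re_eq_add_conj, ← mul_conj', map_sub, map_add, map_mul, map_pow, map_div₀,
      map_natCast, map_neg, conj_conj, map_one, map_ofNat] at hau' hu2' ⊢
    linear_combination (-(n : ℂ) ^ 2 / 2) * hu2 - (n : ℂ) ^ 2 / 2 * hu2' - n * s * hau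
      - n * conj s * hau' - (n : ℂ) ^ 2 * huu
  rw [e1]
  have b1 : -‖l‖ ≤ (l * s).re := by
    have h1 := (abs_le.1 (abs_re_le_norm (l * s))).1
    rw [norm_mul] at h1
    nlinarith [norm_nonneg l]
  have b2 : (a * s ^ 2).re ≤ 1 := by
    refine (re_le_norm _).trans ?_
    rw [norm_mul, ha, one_mul, norm_pow]
    exact pow_le_one₀ (norm_nonneg _) hs
  have b3 : ‖s‖ ^ 2 ≤ 1 := pow_le_one₀ (norm_nonneg _) hs
  have b4 : 0 ≤ 2 * (n : ℝ) * (l * u).re := by positivity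
  linarith

/-- An integrating factor shows that `f` is a constant multiple of a critical Gaussian, so the
constant must vanish. -/
theorem FockSpace.eq_zero_of_deriv_eq {a : ℂ} (ha : ‖a‖ = 1) {l : ℂ} {f : FockSpace}
    (h : ∀ z, deriv f z = (l - a * z) * f z) : f = 0 := by
  have hE : ∀ z, HasDerivAt (fun z => exp (-(l * z - a * z ^ 2 / 2)))
      (exp (-(l * z - a * z ^ 2 / 2)) * -(l * 1 - a * (2 * z) / 2)) z := fun z => by
    have h2 : HasDerivAt (fun z : ℂ => z ^ 2) (2 * z) z := by simpa using hasDerivAt_pow 2 z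
    exact ((((hasDerivAt_id z).const_mul l).sub ((h2.const_mul a).div_const 2)).neg).cexp
  have hd : ∀ z, HasDerivAt (fun z => exp (-(l * z - a * z ^ 2 / 2)) * f z) 0 z := fun z => by
    have h1 : HasDerivAt (fun z => exp (-(l * z - a * z ^ 2 / 2)) * f z)
        (exp (-(l * z - a * z ^ 2 / 2)) * -(l * 1 - a * (2 * z) / 2) * f z
          + exp (-(l * z - a * z ^ 2 / 2)) * deriv f z) z :=
      (hE z).mul (f.differentiable z).hasDerivAt
    have h2 : exp (-(l * z - a * z ^ 2 / 2)) * -(l * 1 - a * (2 * z) / 2) * f z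
        + exp (-(l * z - a * z ^ 2 / 2)) * deriv f z = 0 := by rw [h z]; ring
    rwa [h2] at h1
  have hc := is_const_of_deriv_eq_zero (fun z => (hd z).differentiableAt) fun z => (hd z).deriv
  have hf : ∀ z, f z = f 0 * exp (l * z - a * z ^ 2 / 2) := fun z => by
    have h1 := hc z 0
    have h2 : exp (l * z - a * z ^ 2 / 2) * exp (-(l * z - a * z ^ 2 / 2)) = 1 := by
      rw [← exp_add, add_neg_cancel, exp_zero]
    have h3 : exp (-(l * 0 - a * 0 ^ 2 / 2)) = 1 := by simp
    linear_combination exp (l * z - a * z ^ 2 / 2) * (h1 + f 0 * h3) - f z * h2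
  by_cases h0 : f 0 = 0
  · ext z; rw [hf, h0, zero_mul, FockSpace.zero_apply]
  · exfalso
    refine not_memLp_exp_quadratic ha l ?_
    have h1 := f.memLp.const_mul (f 0)⁻¹
    refine (memLp_congr_ae (Eventually.of_forall fun z => ?_)).1 h1
    simp only [hf z]
    field_simp

/-! ### The three cases of the point spectrum. -/

theorem pointSpectrum_maximalOperator_of_ne_zero {a b d₀₀ d₀₁ d₁₁ : ℂ} (ha : a ≠ 0)
    (hd : d₁₁ ≠ 0) {ψ₀ ψ₁ : ℂ → ℂ} (h₀ : ∀ z, ψ₀ z = d₀₀ + d₀₁ * (a * z + b))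
    (h₁ : ∀ z, ψ₁ z = d₀₁ + d₁₁ * (a * z + b)) :
    pointSpectrum (maximalOperator ![ψ₀, ψ₁]) = Set.range fun k : ℕ =>
      ψ₀ ((-d₀₁ - b * d₁₁) / (a * d₁₁)) + k * deriv ψ₁ ((-d₀₁ - b * d₁₁) / (a * d₁₁)) := by
  set w := (-d₀₁ - b * d₁₁) / (a * d₁₁) with hw
  have hw' : a * d₁₁ * w = -d₀₁ - b * d₁₁ := by rw [hw]; field_simp
  have h₁' : ∀ z, ψ₁ z = a * d₁₁ * (z - w) := fun z => by
    rw [h₁]; linear_combination hw'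
  have hder : deriv ψ₁ w = a * d₁₁ := by
    have : HasDerivAt (fun z => a * d₁₁ * (z - w)) (a * d₁₁ * 1) w :=
      ((hasDerivAt_id w).sub_const w).const_mul _
    rw [funext h₁', this.deriv, mul_one]
  have hψ₀ : Differentiable ℂ ψ₀ := by rw [funext h₀]; fun_prop
  rw [hder]
  ext μ
  rw [mem_pointSpectrum_maximalOperator_iff]
  constructor
  · rintro ⟨f, hf, h⟩
    refine exists_eigenvalue_eq_of_simple_zero hψ₀ f.differentiable ?_ fun z => ?_
    · by_contra! h0
      exact hf (FockSpace.ext h0)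
    · rw [h, h₁']
  · rintro ⟨k, rfl⟩
    -- The exponent `-d₀₁ / d₁₁` makes `ψ₁` times the logarithmic derivative cancel the variation `a
    -- d₀₁ (z - w)` of `ψ₀`.
    refine ⟨FockSpace.powMulExp w (-d₀₁ / d₁₁) k, FockSpace.powMulExp_ne_zero _ _ _, fun z => ?_⟩
    rw [h₁', mul_assoc (a * d₁₁), FockSpace.deriv_powMulExp, h₀ z, h₀ w]
    field_simp
    ring

theorem pointSpectrum_maximalOperator_eq_empty {a b d₀₀ d₀₁ : ℂ} (ha : ‖a‖ = 1)
    (hd : d₀₁ ≠ 0) {ψ₀ ψ₁ : ℂ → ℂ} (h₀ : ∀ z, ψ₀ z = d₀₀ + d₀₁ * (a * z + b))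
    (h₁ : ∀ z, ψ₁ z = d₀₁) : pointSpectrum (maximalOperator ![ψ₀, ψ₁]) = ∅ := by
  rw [Set.eq_empty_iff_forall_notMem]
  intro μ hμ
  obtain ⟨f, hf, h⟩ := mem_pointSpectrum_maximalOperator_iff.1 hμ
  refine hf (FockSpace.eq_zero_of_deriv_eq ha (l := (μ - d₀₀) / d₀₁ - b) fun z => ?_)
  have h2 := h z
  rw [h₀, h₁] at h2
  field_simp
  linear_combination -h2

theorem pointSpectrum_maximalOperator_const {d₀₀ : ℂ} {ψ₀ ψ₁ : ℂ → ℂ} (h₀ : ∀ z, ψ₀ z = d₀₀)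
    (h₁ : ∀ z, ψ₁ z = 0) : pointSpectrum (maximalOperator ![ψ₀, ψ₁]) = {d₀₀} := by
  ext μ
  rw [mem_pointSpectrum_maximalOperator_iff, Set.mem_singleton_iff]
  constructor
  · rintro ⟨f, hf, h⟩
    by_contra hne
    refine hf (FockSpace.ext fun z => ?_)
    have h2 := h z
    rw [h₀, h₁, zero_mul, add_zero] at h2
    by_contra h3
    exact hne (mul_right_cancel₀ h3 h2)
  · rintro rfl
    exact ⟨_, FockSpace.powMulExp_ne_zero 0 0 0, fun z => by rw [h₀, h₁, zero_mul, add_zero]⟩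

theorem corollary6p11 (a b c : ℂ) (habc : IsConjugationParam a b c)
    (ψ₀ ψ₁ : ℂ → ℂ) (hψ₀ : Differentiable ℂ ψ₀) (hψ₁ : Differentiable ℂ ψ₁)
    (T : FockSpace →ₗ.[ℂ] FockSpace) (hT : T ≤ maximalOperator ![ψ₀, ψ₁]) :
    (IsCSelfadjoint (weightedConjugation habc) T ↔
      T = maximalOperator ![ψ₀, ψ₁] ∧
        ∃ d₀₀ d₁₀ d₀₁ d₁₁ : ℂ, d₁₀ = d₀₁ ∧
          (∀ z, ψ₀ z = d₀₀ + d₁₀ * (a * z + b)) ∧ (∀ z, ψ₁ z = d₀₁ + d₁₁ * (a * z + b))) ∧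
    (IsCSelfadjoint (weightedConjugation habc) T →
      ∀ d₀₀ d₁₀ d₀₁ d₁₁ : ℂ, d₁₀ = d₀₁ →
        (∀ z, ψ₀ z = d₀₀ + d₁₀ * (a * z + b)) → (∀ z, ψ₁ z = d₀₁ + d₁₁ * (a * z + b)) →
          (d₁₁ ≠ 0 → pointSpectrum T = Set.range fun k : ℕ =>
            ψ₀ ((-d₀₁ - b * d₁₁) / (a * d₁₁)) + k * deriv ψ₁ ((-d₀₁ - b * d₁₁) / (a * d₁₁))) ∧
          (d₁₁ = 0 → d₀₁ ≠ 0 → pointSpectrum T = ∅) ∧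
          (d₁₁ = 0 → d₀₁ = 0 → pointSpectrum T = {d₀₀})) := by
  refine ⟨⟨fun hs => ?_, ?_⟩, ?_⟩
  · obtain ⟨d₀₀, d₀₁, d₁₁, h₀, h₁⟩ := hs.exists_affine hT
    exact ⟨hs.eq_maximalOperator hT, d₀₀, d₀₁, d₀₁, d₁₁, rfl, h₀, h₁⟩
  · rintro ⟨rfl, d₀₀, _, d₀₁, d₁₁, rfl, h₀, h₁⟩
    exact isCSelfadjoint_maximalOperator habc h₀ h₁
  · rintro hs d₀₀ _ d₀₁ d₁₁ rfl h₀ h₁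
    rw [hs.eq_maximalOperator hT]
    refine ⟨fun hd => pointSpectrum_maximalOperator_of_ne_zero habc.a_ne_zero hd h₀ h₁, ?_, ?_⟩
    · rintro rfl hd
      exact pointSpectrum_maximalOperator_eq_empty habc.norm_a hd h₀ fun z => by rw [h₁]; ring
    · rintro rfl rfl
      exact pointSpectrum_maximalOperator_const (fun z => by rw [h₀]; ring)
        fun z => by rw [h₁]; ring
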